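/- **Definitions.** Fix an alphabet $\Sigma$ and a disjoint set $V$ of variables. A *parse graph* is a finite rooted graph given by disjoint sets $N$ (nonlexical nodes, labelled in $V$) and $L$ (lexemes, labelled in $\Sigma$), a root $r\in N$, and two partial functions with disjoint graphs, $E\subseteq N\times(N\cup L)$ (first child) and $F\subseteq N\times N$ (right sibling), such that the root has no predecessor by $E\cup F$, every other node has exactly one, and every node is reachable from $r$. Let ${<}=((F^{-1})^*\circ E^{-1})^*\circ F\circ E^*$ (relations composed from left to right), and let $m\ll n$ mean that $m<n$ and that $m<p<n$ implies $p\in\{m,n\}$. The *frontier* of a parse graph is the string of all nodes that have no first child, in $\ll$ order; its *yield* is the corresponding string of labels. Let $\Gamma_1,\Gamma_2$ be parse graphs with disjoint node sets, $q$ a nonlexical node of $\Gamma_1$ (the anchor), $s$ the root of $\Gamma_2$ and $t$ a node of $\Gamma_2$ (the target). The *interpolation* of $\Gamma_2$ at $q$ replaces $q$ by $\Gamma_2$: the edge into $q$, if any, becomes an edge of the same kind into $s$ (if $q$ is the root of $\Gamma_1$, then $s$ becomes the root); the first child of $q$, if any, becomes the first child of $t$ if the path from $s$ to $t$ begins with an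 $E$-edge (*down-shift*), and of $s$ otherwise; the right sibling of $q$, if any, becomes the right sibling of $t$ if that path begins with an $F$-edge (*right-shift*), and of $s$ otherwise. If $s=t$ it is an *$\epsilon$-shift*. The interpolation is defined only if the result $\Gamma_3$ is a parse graph, $\Gamma_2$ has exactly one lexeme $\nu$, the frontier of $\Gamma_1$ is of the form $x\alpha$ with $x\in L_1^*$ and $\alpha\in N_1^*$, and the frontier of $\Gamma_3$ has the prefix $x\nu$. A *Graph Interpolation Grammar* (GIG) consists of a set $V$ of variables, the alphabet $\Sigma$, a finite set of rules $(A,\Gamma_2,t)$ with $A\in V$, $\Gamma_2$ a parse graph and $t$ a node of $\Gamma_2$, and a start variable $S\in V$. A derivation starts from the graph with a single nonlexical node labelled $S$; each step applies a rule $(A,\Gamma_2,t)$ by interpolating a disjoint copy of $\Gamma_2$ at an anchor labelled $A$, and scans the label of the lexeme of $\Gamma_2$ as the next input symbol. A string $w$ is accepted if some derivation that scans exactly $w$ ends in a graph of yield $w$. A *Graph Interpolation Language* (GIL) is the set of strings accepted by a GIG. (No GIG accepts the empty string, so the inclusion of the context-free languages is meant up to the empty string.) **Theorem 3.** The class of context-free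 languages is properly included in the class of GILs. More precisely: 1. for every context-free language $K$ over any alphabet, $K\setminus\{\epsilon\}$ is a GIL; 2. for any four distinct symbols $a,b,c,d$ of an alphabet, the language $\{a^nb^nc^nd^n : n\ge 1\}$ is recognized by a GIG with exactly five rules, each of which is a down-shift or an $\epsilon$-shift, and this language is not context-free; 3. hence, over every alphabet with at least four symbols, the class of context-free languages not containing $\epsilon$ is a proper subclass of the class of GILs. -/

import Mathlib

/-! Graph Interpolation Grammars (GIGs) and the languages they recognize. -/

namespace GraphInterp

universe u v

/-- The raw data of a finite parse graph.  Nodes are natural numbers; `V` is the type of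
variables and `T` the type of symbols (hence the two sets of labels are disjoint).
The predicate `IsParseGraph` below says when these data are a parse graph. -/
structure RawGraph (V : Type v) (T : Type u) where
  /-- nonlexical nodes -/
  N : Finset ℕ
  /-- lexemes -/
  L : Finset ℕ
  /-- the root -/
  root : ℕ
  /-- the label assignment (only its values on nodes matter) -/
  label : ℕ → V ⊕ T
  /-- `E m n`: `n` is the first child of `m` -/
  E : ℕ → ℕ → Prop
  /-- `F m n`: `n` is the right sibling of `m` -/
  F : ℕ → ℕ → Prop

namespace RawGraph

variable {V : Type v} {T : Type u}

/-- All nodes of the graph. -/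
def nodes (Γ : RawGraph V T) : Finset ℕ := Γ.N ∪ Γ.L

/-- An edge of either kind. -/
def Edge (Γ : RawGraph V T) (m n : ℕ) : Prop := Γ.E m n ∨ Γ.F m n

/-- Parse graphs: the first-child / right-sibling representation of a tree whose lexemes are
single children without descendants.  (That a lexeme has no child and no sibling follows
from the domains of `E` and `F` and the uniqueness of dominators.)  The root may have right
siblings. -/
structure IsParseGraph (Γ : RawGraph V T) : Prop where
  disjoint : Disjoint Γ.N Γ.L
  root_mem : Γ.root ∈ Γ.N
  label_N : ∀ n ∈ Γ.N, ∃ A : V, Γ.label n = Sum.inl A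
  label_L : ∀ n ∈ Γ.L, ∃ a : T, Γ.label n = Sum.inr a
  E_dom : ∀ m n, Γ.E m n → m ∈ Γ.N ∧ n ∈ Γ.nodes
  F_dom : ∀ m n, Γ.F m n → m ∈ Γ.N ∧ n ∈ Γ.N
  E_fun : ∀ m n n', Γ.E m n → Γ.E m n' → n = n'
  F_fun : ∀ m n n', Γ.F m n → Γ.F m n' → n = n'
  /-- a node is not both the first child and the right sibling of another node -/
  E_F_disjoint : ∀ m n, ¬ (Γ.E m n ∧ Γ.F m n)
  /-- every node except the root has exactly one immediate dominator -/
  dominator : ∀ n ∈ Γ.nodes, n ≠ Γ.root → ∃! m, Γ.Edge m n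
  root_dominator : ∀ m, ¬ Γ.Edge m Γ.root
  /-- the graph is rooted -/
  reachable : ∀ n ∈ Γ.nodes, Relation.ReflTransGen Γ.Edge Γ.root n

/-- `Γ.Parent m p`: `p` is the parent of `m` in the represented tree, i.e. `p` is related to
`m` by a backward path of right-sibling edges followed by a backward first-child edge. -/
def Parent (Γ : RawGraph V T) (m p : ℕ) : Prop :=
  ∃ c, Relation.ReflTransGen Γ.F c m ∧ Γ.E p c

/-- The successor relation `<`: go up any number of times to the parent, then along
one right-sibling edge, then along any number of first-child edges. -/
def Succ (Γ : RawGraph V T) (m n : ℕ) : Prop :=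
  ∃ x y, Relation.ReflTransGen Γ.Parent m x ∧ Γ.F x y ∧ Relation.ReflTransGen Γ.E y n

/-- The immediate successor relation `≪`. -/
def ImmSucc (Γ : RawGraph V T) (m n : ℕ) : Prop :=
  Γ.Succ m n ∧ ∀ p, Γ.Succ m p → Γ.Succ p n → m = p ∨ n = p

/-- Terminal nodes: nodes without a first child. -/
def IsTerminal (Γ : RawGraph V T) (n : ℕ) : Prop :=
  n ∈ Γ.nodes ∧ ∀ m, ¬ Γ.E n m

/-- `w` is the frontier of `Γ`: the string of all its terminal nodes, in `≪` order. -/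
def IsFrontier (Γ : RawGraph V T) (w : List ℕ) : Prop :=
  w.Nodup ∧ (∀ n, n ∈ w ↔ Γ.IsTerminal n) ∧ w.IsChain Γ.ImmSucc

/-- The path from the root to `t` has positive length and starts with a first-child edge. -/
def IsDownShift (Γ : RawGraph V T) (t : ℕ) : Prop :=
  ∃ s', Γ.E Γ.root s' ∧ Relation.ReflTransGen Γ.Edge s' t

/-- The path from the root to `t` has positive length and starts with a right-sibling edge. -/
def IsRightShift (Γ : RawGraph V T) (t : ℕ) : Prop :=
  ∃ s', Γ.F Γ.root s' ∧ Relation.ReflTransGen Γ.Edge s' t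

/-- The path from the root to `t` has length zero. -/
def IsEpsilonShift (Γ : RawGraph V T) (t : ℕ) : Prop := t = Γ.root

/-- The result of plugging `Γ₂` into `Γ₁` at the anchor `q`, with target `t`.
The root `s` of `Γ₂` takes the place of `q`, except that the child of `q` becomes the child
of `t` in a down-shift, and the right sibling of `q` becomes the right sibling of `t` in a
right-shift. -/
def interpolate (Γ₁ Γ₂ : RawGraph V T) (q t : ℕ) : RawGraph V T where
  N := Γ₁.N.erase q ∪ Γ₂.N
  L := Γ₁.L ∪ Γ₂.L
  root := if q = Γ₁.root then Γ₂.root else Γ₁.root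
  label n := if n ∈ Γ₂.nodes then Γ₂.label n else Γ₁.label n
  E m n :=
    ((Γ₁.E m n ∨ Γ₂.E m n) ∧ m ≠ q ∧ n ≠ q) ∨
    (Γ₁.E m q ∧ n = Γ₂.root) ∨
    (Γ₁.E q n ∧ ((Γ₂.IsDownShift t ∧ m = t) ∨ (¬ Γ₂.IsDownShift t ∧ m = Γ₂.root)))
  F m n :=
    ((Γ₁.F m n ∨ Γ₂.F m n) ∧ m ≠ q ∧ n ≠ q) ∨
    (Γ₁.F m q ∧ n = Γ₂.root) ∨
    (Γ₁.F q n ∧ ((Γ₂.IsRightShift t ∧ m = t) ∨ (¬ Γ₂.IsRightShift t ∧ m = Γ₂.root)))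

/-- The interpolation of `Γ₂` into `Γ₁` at `q` with target `t` is defined.  (There is exactly
one path from the root of `Γ₂` to the node `t`, since `Γ₂` is a parse graph.) -/
structure InterpolationDefined (Γ₁ Γ₂ : RawGraph V T) (q t : ℕ) : Prop where
  context_graph : Γ₁.IsParseGraph
  addendum_graph : Γ₂.IsParseGraph
  anchor_mem : q ∈ Γ₁.N
  target_mem : t ∈ Γ₂.nodes
  /-- the result is a parse graph -/
  result_graph : (interpolate Γ₁ Γ₂ q t).IsParseGraph
  /-- disjunction constraint -/
  disjunction : Disjoint Γ₁.nodes Γ₂.nodes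
  /-- lexicalization constraint -/
  lexicalization : Γ₂.L.card = 1
  /-- context constraint and frontier constraint -/
  frontier : ∃ x α δ β ζ : List ℕ, ∃ ν : ℕ,
    Γ₁.IsFrontier (x ++ α) ∧ (∀ n ∈ x, n ∈ Γ₁.L) ∧ (∀ n ∈ α, n ∈ Γ₁.N) ∧
    Γ₂.IsFrontier (δ ++ ν :: β) ∧ ν ∈ Γ₂.L ∧ (∀ n ∈ δ, n ∈ Γ₂.N) ∧ (∀ n ∈ β, n ∈ Γ₂.N) ∧
    (interpolate Γ₁ Γ₂ q t).IsFrontier (x ++ ν :: ζ)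

/-- Renaming the nodes of a graph. -/
def rename (f : Equiv.Perm ℕ) (Γ : RawGraph V T) : RawGraph V T where
  N := Γ.N.map f.toEmbedding
  L := Γ.L.map f.toEmbedding
  root := f Γ.root
  label n := Γ.label (f.symm n)
  E m n := Γ.E (f.symm m) (f.symm n)
  F m n := Γ.F (f.symm m) (f.symm n)

/-- The graph that consists of one nonlexical node, labelled `S`. -/
def single (S : V) : RawGraph V T where
  N := {0}
  L := ∅
  root := 0
  label _ := Sum.inl S
  E _ _ := False
  F _ _ := False

end RawGraph

/-- An interpolation rule: a context pattern, an addendum and an interpolation target. -/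
structure Rule (V : Type v) (T : Type u) where
  pattern : V
  addendum : RawGraph V T
  target : ℕ
  isParseGraph : addendum.IsParseGraph
  target_mem : target ∈ addendum.nodes

/-- A Graph Interpolation Grammar over the alphabet `T`: variables, a finite set of
interpolation rules, and a start variable. -/
structure GIG (T : Type u) where
  V : Type
  rules : Set (Rule V T)
  finite_rules : rules.Finite
  start : V

namespace GIG

variable {T : Type u}

/-- One move `⟨Γ, a x⟩ ↦ ⟨Γ', x⟩` between instantaneous descriptions: some rule, whose
addendum is first replaced by an isomorphic copy, is applied at an anchor `q` labelled with
the context pattern of the rule, and `a` is the label of the lexeme of the addendum. -/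
def Step (G : GIG T) (I J : RawGraph G.V T × List T) : Prop :=
  ∃ ρ ∈ G.rules, ∃ (f : Equiv.Perm ℕ) (q ν : ℕ) (a : T),
    I.1.label q = Sum.inl ρ.pattern ∧
    RawGraph.InterpolationDefined I.1 (ρ.addendum.rename f) q (f ρ.target) ∧
    J.1 = RawGraph.interpolate I.1 (ρ.addendum.rename f) q (f ρ.target) ∧
    ν ∈ (ρ.addendum.rename f).L ∧ (ρ.addendum.rename f).label ν = Sum.inr a ∧
    I.2 = a :: J.2

/-- The language recognized by `G`: the strings `w` such that `⟨Γ₀, w⟩`, with `Γ₀` the single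
node labelled with the start variable, is mapped to some `⟨Γ, ε⟩` with `Γ` of yield `w`. -/
def language (G : GIG T) : Language T :=
  {w | ∃ (Γ : RawGraph G.V T) (l : List ℕ),
    Relation.ReflTransGen G.Step (RawGraph.single G.start, w) (Γ, []) ∧
    Γ.IsFrontier l ∧ l.map Γ.label = w.map Sum.inr}

end GIG

/-- Graph Interpolation Languages. -/
def IsGIL {T : Type u} (L : Language T) : Prop := ∃ G : GIG T, G.language = L

/-- The language of the strings `aⁿ bⁿ cⁿ dⁿ`, `n ≥ 1`. -/
def fourCounts {T : Type u} (a b c d : T) : Language T :=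
  {w | ∃ n : ℕ, 1 ≤ n ∧ w = List.replicate n a ++ List.replicate n b ++
    List.replicate n c ++ List.replicate n d}

end GraphInterp

/-! The inclusion of the context-free languages rests on a Greibach normal form, obtained here in
semantic terms.  For a context-free grammar, the nonempty languages of suffixes of right-hand sides
and of left-corner strings form a finite system of languages of nonempty strings in which every
language is a union of products of a letter and at most three members of the system
(`exists_greibachSystem`): in a string `a w` derived from a symbol, the left spine of the derivation
ends in the letter `a`, and `w` is what branches off to the right of the spine
(`Gen.exists_leftCorner`, `LeftCorner.exists_first_nonempty`).  Such a production `A → a As` becomes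
an `ε`-shift rule whose addendum has the frontier `a As`.  The rule can only be applied at a terminal
node, since the root of the addendum has a child already; hence a move rewrites one label of the
frontier.  So the strings denoted by the frontier remain in the language, and conversely the
factorization of the remaining input dictates the moves.

The same systems show that `aⁿbⁿcⁿdⁿ` is not context-free.  Every long string has a factor of length
between `k` and `3 k` that may be exchanged for any other string of one of the finitely many languages
(`exists_exchangeable_factor`).  For infinitely many values of `k`, two factors of different lengths
belong to the same language and avoid the same one of the letters `a` and `d`; their exchange changes
the length of the string but not the number of those letters.

The grammar for `aⁿbⁿcⁿdⁿ` has an initial rule with frontier `a B C D` in which `B C` is the frontier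
below a node `mid`, a down-shift rule that replaces `mid` with a tree with frontier `a B t C D` where
the former children of `mid` are attached to `t`, and three rules that scan `b`, `c`, `d` for `B`, `C`,
`D`.  The invariant is that the frontier, with `B`, `C`, `D` read as `b`, `c`, `d` and with brackets
around the part below `mid`, is `aⁿ [ bⁿ cⁿ ] dⁿ` (`bracketed_of_reachable`).

Graphs are handled through trees in first-child / right-sibling form.  `Rep Γ t` says that the tree
`t` represents the graph `Γ`; such a graph is a parse graph (`Rep.isParseGraph`) whose only frontier
is the list of leaves of `t` (`Rep.isFrontier_iff`), and interpolation at a node becomes the filling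
of a one-hole context (`Rep.interpolate_leaf`, `Rep.interpolate_down`). -/

namespace GraphInterp

universe u v

/-! ### Greibach systems for context-free languages -/

section Greibach

variable {T : Type*} {g : ContextFreeGrammar T}

/-- Big-step semantics of a context-free grammar: `Gen g σ w` says that the string of symbols `σ`
derives the terminal string `w`. -/
inductive Gen (g : ContextFreeGrammar T) : List (Symbol T g.NT) → List T → Prop
  | nil : Gen g [] []
  | term (a : T) {σ w} : Gen g σ w → Gen g (.terminal a :: σ) (a :: w)
  | nt {r σ w₁ w₂} : r ∈ g.rules → Gen g r.output w₁ → Gen g σ w₂ →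
      Gen g (.nonterminal r.input :: σ) (w₁ ++ w₂)

theorem Gen.append {σ τ : List (Symbol T g.NT)} {w v : List T} (h : Gen g σ w) (h' : Gen g τ v) :
    Gen g (σ ++ τ) (w ++ v) := by
  induction h with
  | nil => exact h'
  | term a _ ih => exact .term a ih
  | nt hr h₁ _ _ ih => rw [List.append_assoc]; exact .nt hr h₁ ih

theorem Gen.of_append {σ τ : List (Symbol T g.NT)} {w : List T} (h : Gen g (σ ++ τ) w) :
    ∃ w₁ w₂, w = w₁ ++ w₂ ∧ Gen g σ w₁ ∧ Gen g τ w₂ := by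
  induction σ generalizing w with
  | nil => exact ⟨[], w, rfl, .nil, h⟩
  | cons X σ ih =>
    cases h with
    | term a h =>
      obtain ⟨w₁, w₂, rfl, h₁, h₂⟩ := ih h
      exact ⟨_, w₂, rfl, .term a h₁, h₂⟩
    | nt hr h₀ h =>
      obtain ⟨w₁, w₂, rfl, h₁, h₂⟩ := ih h
      exact ⟨_, w₂, (List.append_assoc ..).symm, .nt hr h₀ h₁, h₂⟩

theorem Gen.of_output {r : ContextFreeRule T g.NT} (hr : r ∈ g.rules) {w : List T}
    (h : Gen g r.output w) : Gen g [.nonterminal r.input] w := by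
  simpa using Gen.nt hr h .nil

theorem gen_terminals (w : List T) : Gen g (w.map .terminal) w := by
  induction w with
  | nil => exact .nil
  | cons a w ih => exact .term a ih

theorem gen_iff_derives {σ : List (Symbol T g.NT)} {w : List T} :
    Gen g σ w ↔ g.Derives σ (w.map .terminal) := by
  constructor
  · intro h
    induction h with
    | nil => exact Relation.ReflTransGen.refl
    | term a _ ih => exact ih.append_left [.terminal a]
    | @nt r σ w₁ w₂ hr _ _ ih₁ ih₂ =>
      have h₁ : g.Produces (.nonterminal r.input :: σ) (r.output ++ σ) := ⟨r, hr, .head σ⟩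
      rw [List.map_append]
      exact h₁.trans_derives ((ih₁.append_right σ).trans (ih₂.append_left _))
  · intro h
    induction h using Relation.ReflTransGen.head_induction_on with
    | refl => exact gen_terminals w
    | head h _ ih =>
      obtain ⟨r, hr, h⟩ := h
      obtain ⟨p, q, rfl, rfl⟩ := h.exists_parts
      obtain ⟨_, w₃, rfl, h₁, h₃⟩ := ih.of_append
      obtain ⟨w₁, w₂, rfl, h₁, h₂⟩ := h₁.of_append
      exact (h₁.append (.of_output hr h₂)).append h₃

/-- The left-corner relation: `Y` derives a string `X u'` along the left spine of a derivation
tree (where everything to the left of the spine derives the empty string), and what stands to the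
right of the spine derives `u`. -/
inductive LeftCorner (g : ContextFreeGrammar T) (Y : Symbol T g.NT) :
    Symbol T g.NT → List T → Prop
  | refl : LeftCorner g Y Y []
  | step {r γ X δ v u} : r ∈ g.rules → r.output = γ ++ X :: δ → Gen g γ [] → Gen g δ v →
      LeftCorner g Y (.nonterminal r.input) u → LeftCorner g Y X (v ++ u)

theorem LeftCorner.trans {X Y Z : Symbol T g.NT} {u v : List T} (h₁ : LeftCorner g Z X u)
    (h₂ : LeftCorner g Y Z v) : LeftCorner g Y X (u ++ v) := by
  induction h₁ with
  | refl => exact h₂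
  | step hr ho hγ hδ _ ih => rw [List.append_assoc]; exact .step hr ho hγ hδ ih

/-- If `X` is a left corner of `Y`, a string derived from `X` extends to one derived from `Y`. -/
theorem LeftCorner.gen {X Y : Symbol T g.NT} {u v : List T} (h : LeftCorner g Y X u)
    (hv : Gen g [X] v) : Gen g [Y] (v ++ u) := by
  induction h generalizing v with
  | refl => simpa using hv
  | @step r γ X δ v' u' hr ho hγ hδ _ ih =>
    rw [← List.append_assoc]
    refine ih (.of_output hr ?_)
    rw [ho]
    simpa using hγ.append (hv.append hδ)

/-- A string of symbols that derives `a w` contains a symbol with left corner `a`, preceded only by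
symbols that derive the empty string. -/
theorem Gen.exists_leftCorner {σ : List (Symbol T g.NT)} {a : T} {w : List T}
    (h : Gen g σ (a :: w)) :
    ∃ γ Z δ w₁ w₂, σ = γ ++ Z :: δ ∧ Gen g γ [] ∧ w = w₁ ++ w₂ ∧
      LeftCorner g Z (.terminal a) w₁ ∧ Gen g δ w₂ := by
  generalize hx : a :: w = x at h
  induction h generalizing w with
  | nil => simp at hx
  | @term b σ v h _ =>
    obtain ⟨rfl, rfl⟩ := List.cons.inj hx
    exact ⟨[], _, σ, [], w, rfl, .nil, rfl, .refl, h⟩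
  | @nt r σ v₁ v₂ hr h₁ h₂ ih₁ ih₂ =>
    cases v₁ with
    | nil =>
      obtain ⟨γ, Z, δ, w₁, w₂, rfl, hγ, rfl, hZ, hδ⟩ := ih₂ hx
      exact ⟨_ :: γ, Z, δ, w₁, w₂, rfl, .nt hr h₁ hγ, rfl, hZ, hδ⟩
    | cons b v₁ =>
      obtain ⟨rfl, rfl⟩ := List.cons.inj hx
      obtain ⟨γ, Z, δ, w₁, w₂, ho, hγ, rfl, hZ, hδ⟩ := ih₁ rfl
      refine ⟨[], _, σ, w₁ ++ w₂, v₂, rfl, .nil, rfl, hZ.trans ?_, h₂⟩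
      simpa using LeftCorner.step hr ho hγ hδ .refl

/-- The lowest node on a left spine at which something nonempty branches off to the right. -/
theorem LeftCorner.exists_first_nonempty {X Y : Symbol T g.NT} {u : List T}
    (h : LeftCorner g Y X u) (hu : u ≠ []) :
    ∃ r ∈ g.rules, ∃ δ v u', δ <:+ r.output ∧ u = v ++ u' ∧ v ≠ [] ∧ Gen g δ v ∧
      LeftCorner g Y (.nonterminal r.input) u' ∧
      ∀ v' u', Gen g δ v' → LeftCorner g Y (.nonterminal r.input) u' →
        LeftCorner g Y X (v' ++ u') := by
  induction h with
  | refl => exact absurd rfl hu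
  | @step r γ X δ v u hr ho hγ hδ h ih =>
    by_cases hv : v = []
    · subst hv
      obtain ⟨r', hr', δ', v', u', hs, rfl, hv', hg, hl, hc⟩ := ih hu
      exact ⟨r', hr', δ', v', u', hs, rfl, hv', hg, hl,
        fun v'' u'' h₁ h₂ => by
          simpa using LeftCorner.step hr ho hγ hδ (hc v'' u'' h₁ h₂)⟩
    · exact ⟨r, hr, δ, v, u, ⟨γ ++ [X], by simp [ho]⟩, rfl, hv, hδ, h,
        fun v' u' h₁ h₂ => .step hr ho hγ h₁ h₂⟩

/-- The language of the nonempty strings with a property. -/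
def nonemptyPart (P : List T → Prop) : Language T := {v | P v ∧ v ≠ []}

/-- A possibly empty factor of a word is matched by at most one language of nonempty strings. -/
theorem exists_optional_factor {P : List T → Prop} {w : List T} (hw : P w) :
    ∃ l : List (Language T), l.length ≤ 1 ∧
      (∀ K ∈ l, K = nonemptyPart P) ∧ w ∈ l.prod ∧ ∀ v ∈ l.prod, P v := by
  by_cases h : w = []
  · subst h
    refine ⟨[], by simp, by simp, by simp [Language.mem_one], fun v hv => ?_⟩
    rw [List.prod_nil, Language.mem_one] at hv
    exact hv ▸ hw
  · refine ⟨[nonemptyPart P], by simp, by simp, ?_, ?_⟩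
    · rw [List.prod_singleton]; exact ⟨hw, h⟩
    · intro v hv
      rw [List.prod_singleton] at hv
      exact hv.1

/-- The strings of symbols that matter for the Greibach system: suffixes of right-hand sides, and
the initial symbol. -/
def sententialSuffixes (g : ContextFreeGrammar T) : Set (List (Symbol T g.NT)) :=
  insert [.nonterminal g.initial] (⋃ r ∈ g.rules, {δ | δ <:+ r.output})

/-- The symbols that occur in a grammar. -/
def occurringSymbols (g : ContextFreeGrammar T) : Set (Symbol T g.NT) :=
  insert (.nonterminal g.initial)
    (⋃ r ∈ g.rules, insert (.nonterminal r.input) {X | X ∈ r.output})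

theorem finite_sententialSuffixes (g : ContextFreeGrammar T) : (sententialSuffixes g).Finite := by
  refine .insert _ (g.rules.finite_toSet.biUnion fun r _ => ?_)
  exact (r.output.tails.finite_toSet).subset fun δ hδ => by simpa using hδ

theorem finite_occurringSymbols (g : ContextFreeGrammar T) : (occurringSymbols g).Finite :=
  .insert _ (g.rules.finite_toSet.biUnion fun r _ => .insert _ r.output.finite_toSet)

theorem mem_sententialSuffixes {r : ContextFreeRule T g.NT} (hr : r ∈ g.rules)
    {δ : List (Symbol T g.NT)} (h : δ <:+ r.output) : δ ∈ sententialSuffixes g :=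
  .inr (Set.mem_biUnion hr h)

theorem mem_occurringSymbols_of_output {r : ContextFreeRule T g.NT} (hr : r ∈ g.rules)
    {X : Symbol T g.NT} (h : X ∈ r.output) : X ∈ occurringSymbols g :=
  .inr (Set.mem_biUnion hr (.inr h))

theorem mem_occurringSymbols_of_input {r : ContextFreeRule T g.NT} (hr : r ∈ g.rules) :
    .nonterminal r.input ∈ occurringSymbols g :=
  .inr (Set.mem_biUnion hr (.inl rfl))

theorem sententialSuffixes_of_suffix {δ δ' : List (Symbol T g.NT)} (h : δ ∈ sententialSuffixes g)
    (h' : δ' <:+ δ) (hne : δ' ≠ δ) (hδ' : δ' ≠ []) : δ' ∈ sententialSuffixes g := by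
  rcases h with rfl | h
  · obtain ⟨t, ht⟩ := h'
    rcases t with _ | ⟨x, t⟩
    · exact absurd ht hne
    · simp_all
  · simp only [Set.mem_iUnion] at h
    obtain ⟨r, hr, h⟩ := h
    exact mem_sententialSuffixes hr (h'.trans h)

theorem occurringSymbols_of_mem {δ : List (Symbol T g.NT)} (h : δ ∈ sententialSuffixes g)
    {X : Symbol T g.NT} (hX : X ∈ δ) : X ∈ occurringSymbols g := by
  rcases h with rfl | h
  · rw [List.mem_singleton] at hX; exact hX ▸ .inl rfl
  · simp only [Set.mem_iUnion] at h
    obtain ⟨r, hr, h⟩ := h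
    exact mem_occurringSymbols_of_output hr (h.subset hX)

theorem LeftCorner.mem_occurringSymbols {X Y : Symbol T g.NT} {u : List T}
    (h : LeftCorner g Y X u) (hY : Y ∈ occurringSymbols g) : X ∈ occurringSymbols g := by
  cases h with
  | refl => exact hY
  | step hr ho => exact mem_occurringSymbols_of_output hr (by simp [ho])

/-- The nonempty strings derived by a string of symbols. -/
def genLang (g : ContextFreeGrammar T) (δ : List (Symbol T g.NT)) : Language T :=
  nonemptyPart (Gen g δ)

/-- The nonempty strings `u` with `LeftCorner g Y X u`. -/
def cornerLang (g : ContextFreeGrammar T) (Y X : Symbol T g.NT) : Language T :=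
  nonemptyPart (LeftCorner g Y X)

/-- The languages that serve as the nonterminals of the Greibach system of a grammar. -/
def greibachLangs (g : ContextFreeGrammar T) : Set (Language T) :=
  genLang g '' sententialSuffixes g ∪
    Set.image2 (cornerLang g) (occurringSymbols g) (occurringSymbols g)

theorem nil_notMem_of_greibachLangs {K : Language T} (hK : K ∈ greibachLangs g) : [] ∉ K := by
  rcases hK with ⟨δ, -, rfl⟩ | ⟨Y, -, X, -, rfl⟩ <;> exact fun h => h.2 rfl

/-- A nonempty string derived by a suffix factors as a terminal, a left-corner string and a string
derived by a shorter suffix. -/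
theorem genLang_factor {δ : List (Symbol T g.NT)} (hδ : δ ∈ sententialSuffixes g) {a : T}
    {w : List T} (h : Gen g δ (a :: w)) :
    .terminal a ∈ occurringSymbols g ∧ ∃ l : List (Language T), l.length ≤ 2 ∧
      (∀ K ∈ l, K ∈ greibachLangs g) ∧ w ∈ l.prod ∧ ∀ v ∈ l.prod, Gen g δ (a :: v) := by
  obtain ⟨γ, Z, δ', w₁, w₂, rfl, hγ, rfl, hZ, hδ'⟩ := h.exists_leftCorner
  have hZo : Z ∈ occurringSymbols g := occurringSymbols_of_mem hδ (by simp)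
  have ha := hZ.mem_occurringSymbols hZo
  obtain ⟨l₁, hl₁, hm₁, hw₁, hp₁⟩ := exists_optional_factor (P := LeftCorner g Z (.terminal a)) hZ
  obtain ⟨l₂, hl₂, hm₂, hw₂, hp₂⟩ := exists_optional_factor (P := Gen g δ') hδ'
  refine ⟨ha, l₁ ++ l₂, by simp; omega, fun K hK => ?_, ?_, fun v hv => ?_⟩
  · rcases List.mem_append.1 hK with hK | hK
    · exact .inr ⟨Z, hZo, _, ha, (hm₁ K hK).symm⟩
    · by_cases hn : δ' = []
      · -- the empty suffix derives no nonempty string, so its language does not occur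
        subst hn
        have : w₂ = [] := by cases hδ'; rfl
        subst this
        rcases l₂ with _ | ⟨K', _ | _⟩
        · simp at hK
        · rw [List.prod_singleton, hm₂ K' (by simp)] at hw₂
          exact absurd rfl hw₂.2
        · simp at hl₂
      · refine .inl ⟨δ', sententialSuffixes_of_suffix hδ ⟨γ ++ [Z], by simp⟩ (fun h => ?_) hn,
          (hm₂ K hK).symm⟩
        have := congrArg List.length h
        simp at this
        omega
  · rw [List.prod_append, Language.mem_mul]
    exact ⟨w₁, hw₁, w₂, hw₂, rfl⟩
  · rw [List.prod_append, Language.mem_mul] at hv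
    obtain ⟨v₁, hv₁, v₂, hv₂, rfl⟩ := hv
    simpa using hγ.append ((((hp₁ v₁ hv₁).gen (.term a .nil)).append (hp₂ v₂ hv₂)))

theorem greibachLangs_factor {K : Language T} (hK : K ∈ greibachLangs g) {a : T} {w : List T}
    (h : a :: w ∈ K) :
    .terminal a ∈ occurringSymbols g ∧ ∃ l : List (Language T), l.length ≤ 3 ∧
      (∀ K' ∈ l, K' ∈ greibachLangs g) ∧ w ∈ l.prod ∧ ∀ v ∈ l.prod, a :: v ∈ K := by
  rcases hK with ⟨δ, hδ, rfl⟩ | ⟨Y, hY, X, hX, rfl⟩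
  · obtain ⟨ha, l, hl, hm, hw, hp⟩ := genLang_factor hδ h.1
    exact ⟨ha, l, hl.trans (by simp), hm, hw, fun v hv => ⟨hp v hv, by simp⟩⟩
  · obtain ⟨r, hr, δ, v, u, hδ, he, hv, hg, hl, hc⟩ := h.1.exists_first_nonempty h.2
    obtain ⟨b, v, rfl⟩ := List.exists_cons_of_ne_nil hv
    obtain ⟨rfl, rfl⟩ := List.cons.inj he
    obtain ⟨ha, l, hll, hm, hw, hp⟩ := genLang_factor (mem_sententialSuffixes hr hδ) hg
    obtain ⟨l', hl', hm', hw', hp'⟩ :=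
      exists_optional_factor (P := LeftCorner g Y (.nonterminal r.input)) hl
    refine ⟨ha, l ++ l', by simp; omega, fun K hK => ?_, ?_, fun x hx => ⟨?_, by simp⟩⟩
    · rcases List.mem_append.1 hK with hK | hK
      · exact hm K hK
      · exact .inr ⟨Y, hY, _, mem_occurringSymbols_of_input hr, (hm' K hK).symm⟩
    · rw [List.prod_append, Language.mem_mul]
      exact ⟨v, hw, u, hw', rfl⟩
    · rw [List.prod_append, Language.mem_mul] at hx
      obtain ⟨v₁, hv₁, v₂, hv₂, rfl⟩ := hx
      exact hc _ _ (hp v₁ hv₁) (hp' v₂ hv₂)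

/-- A Greibach system: finitely many languages of nonempty strings, each of which is the union of
finitely many products of a letter and at most three languages of the system.  (The products that
are needed are the ones contained in the language, so the equations need not be named.) -/
structure GreibachSystem (T : Type*) where
  /-- the number of languages -/
  n : ℕ
  /-- the languages -/
  lang : Fin n → Language T
  /-- the letters that occur -/
  letters : Set T
  finite_letters : letters.Finite
  nil_notMem : ∀ i, [] ∉ lang i
  mem_letters : ∀ i a w, a :: w ∈ lang i → a ∈ letters
  factor : ∀ i a w, a :: w ∈ lang i → ∃ is : List (Fin n), is.length ≤ 3 ∧
    w ∈ (is.map lang).prod ∧ ∀ v ∈ (is.map lang).prod, a :: v ∈ lang i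

/-- Greibach normal form, in semantic terms. -/
theorem exists_greibachSystem {L : Language T} (hL : L.IsContextFree) :
    ∃ (S : GreibachSystem T) (s : Fin S.n), ∀ w, w ∈ S.lang s ↔ w ∈ L ∧ w ≠ [] := by
  obtain ⟨g, rfl⟩ := hL
  have hfin : (greibachLangs g).Finite :=
    ((finite_sententialSuffixes g).image _).union
      ((finite_occurringSymbols g).image2 _ (finite_occurringSymbols g))
  have := hfin.to_subtype
  obtain ⟨n, ⟨e⟩⟩ := Finite.exists_equiv_fin (greibachLangs g)
  have hprod : ∀ l : List (Language T), (∀ K ∈ l, K ∈ greibachLangs g) →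
      ∃ is : List (Fin n), is.map (fun i => (e.symm i : Language T)) = l := by
    intro l hl
    induction l with
    | nil => exact ⟨[], rfl⟩
    | cons K l ih =>
      obtain ⟨is, rfl⟩ := ih fun K' h => hl K' (.tail _ h)
      exact ⟨e ⟨K, hl K (.head _)⟩ :: is, by simp⟩
  refine ⟨⟨n, fun i => e.symm i, {a | Symbol.terminal a ∈ occurringSymbols g},
    (finite_occurringSymbols g).preimage (by intro a _ b _ h; simpa using h),
    fun i => nil_notMem_of_greibachLangs (e.symm i).2,
    fun i a w h => (greibachLangs_factor (e.symm i).2 h).1, fun i a w h => ?_⟩,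
    e ⟨genLang g [.nonterminal g.initial], .inl ⟨_, .inl rfl, rfl⟩⟩, fun w => ?_⟩
  · obtain ⟨-, l, hl, hm, hw, hp⟩ := greibachLangs_factor (e.symm i).2 h
    obtain ⟨is, rfl⟩ := hprod l hm
    exact ⟨is, by simpa using hl, hw, hp⟩
  · simp only [Equiv.symm_apply_apply]
    rw [ContextFreeGrammar.mem_language_iff, ← gen_iff_derives]
    rfl

end Greibach

/-! ### The language of the strings `aⁿbⁿcⁿdⁿ` is not context-free -/

section NotContextFree

variable {T : Type*}

/-- One of at most `k` factors has at least the average length. -/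
theorem exists_middle_factor {S : GreibachSystem T} {is : List (Fin S.n)} {w : List T}
    {k m : ℕ} (hk : is.length ≤ k) (hw : w ∈ (is.map S.lang).prod) (hm : k * m ≤ w.length)
    (h0 : 0 < w.length) :
    ∃ j u v y, w = u ++ v ++ y ∧ v ∈ S.lang j ∧ m ≤ v.length ∧
      ∀ v' ∈ S.lang j, u ++ v' ++ y ∈ (is.map S.lang).prod := by
  induction is generalizing k w with
  | nil =>
    rw [List.map_nil, List.prod_nil, Language.mem_one] at hw
    simp [hw] at h0
  | cons i is ih =>
    rw [List.map_cons, List.prod_cons, Language.mem_mul] at hw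
    obtain ⟨v, hv, y, hy, rfl⟩ := hw
    by_cases hvm : m ≤ v.length
    · refine ⟨i, [], v, y, by simp, hv, hvm, fun v' hv' => ?_⟩
      rw [List.map_cons, List.prod_cons, Language.mem_mul]
      exact ⟨v', hv', y, hy, by simp⟩
    · obtain ⟨k, rfl⟩ : ∃ k', k = k' + 1 := ⟨k - 1, by simp at hk; omega⟩
      simp only [List.length_append, Nat.add_mul, one_mul] at hm h0
      have hy0 : 0 < y.length := by
        by_contra! hc
        have hc : y.length = 0 := by omega
        rw [hc] at hm
        omega
      obtain ⟨j, u, x, z, rfl, hx, hmx, hc⟩ := ih (k := k) (by simpa using hk) hy (by omega) hy0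
      refine ⟨j, v ++ u, x, z, by simp, hx, hmx, fun v' hv' => ?_⟩
      rw [List.map_cons, List.prod_cons, Language.mem_mul]
      exact ⟨v, hv, _, hc v' hv', by simp⟩

/-- A long string in a language of a Greibach system contains a factor of length between `k`
and `3 * k` that can be exchanged for any other string of one of the languages. -/
theorem exists_exchangeable_factor (S : GreibachSystem T) (k : ℕ) (hk : 1 ≤ k) (i : Fin S.n)
    (w : List T) (hw : w ∈ S.lang i) (hlen : k ≤ w.length) :
    ∃ j u v y, w = u ++ v ++ y ∧ v ∈ S.lang j ∧ k ≤ v.length ∧ v.length ≤ 3 * k ∧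
      ∀ v' ∈ S.lang j, u ++ v' ++ y ∈ S.lang i := by
  induction hl : w.length using Nat.strong_induction_on generalizing i w with
  | _ l ih =>
    subst hl
    by_cases hle : w.length ≤ 3 * k
    · exact ⟨i, [], w, [], by simp, hw, hlen, hle, fun v' h => by simpa using h⟩
    · obtain ⟨a, w, rfl⟩ : ∃ a w', w = a :: w' :=
        List.exists_cons_of_ne_nil (by rintro rfl; exact S.nil_notMem i hw)
      obtain ⟨is, his, hp, hc⟩ := S.factor i a w hw
      simp only [List.length_cons, not_le] at hle ih
      obtain ⟨j, u, v, y, rfl, hv, hmv, hc'⟩ :=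
        exists_middle_factor (m := k) his hp (by omega) (by omega)
      simp only [List.length_append] at ih
      obtain ⟨j', u', v', y', rfl, hv', h₁, h₂, h₃⟩ :=
        ih v.length (by omega) j v hv (by omega) rfl
      refine ⟨j', a :: (u ++ u'), v', y' ++ y, by simp, hv', h₁, h₂, fun x hx => ?_⟩
      have := hc _ (hc' _ (h₃ x hx))
      simpa using this

/-- A factor of `aⁿbⁿcⁿdⁿ` of length at most `2n` does not contain both `a` and `d`. -/
theorem notMem_of_short_factor {a b c d : T} (hnd : [a, b, c, d].Nodup) {n : ℕ} {u v y : List T}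
    (h : u ++ v ++ y = List.replicate n a ++ List.replicate n b ++ List.replicate n c ++
      List.replicate n d) (hv : v.length ≤ 2 * n) (ha : a ∈ v) : d ∉ v := by
  intro hd
  simp only [List.nodup_cons, List.mem_cons, List.not_mem_nil, not_or] at hnd
  obtain ⟨i, hi, hia⟩ := List.getElem_of_mem ha
  obtain ⟨j, hj, hjd⟩ := List.getElem_of_mem hd
  have hlook : ∀ k (hk : k < v.length), (List.replicate n a ++ List.replicate n b ++
      List.replicate n c ++ List.replicate n d)[u.length + k]? = some v[k] := by
    intro k hk
    rw [← h, List.append_assoc, List.getElem?_append_right (by omega),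
      List.getElem?_append_left (by omega), Nat.add_sub_cancel_left, List.getElem?_eq_getElem hk]
  have h1 := hlook i hi
  have h2 := hlook j hj
  rw [hia] at h1
  rw [hjd] at h2
  simp only [List.getElem?_append, List.getElem?_replicate, List.length_append,
    List.length_replicate] at h1 h2
  have hia' : u.length + i < n := by grind
  have hjd' : 3 * n ≤ u.length + j := by grind
  omega

theorem length_eq_of_mem_fourCounts [DecidableEq T] {a b c d : T} (hnd : [a, b, c, d].Nodup)
    {w : List T} (hw : w ∈ fourCounts a b c d) :
    w.length = 4 * w.count a ∧ w.length = 4 * w.count d := by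
  obtain ⟨n, -, rfl⟩ := hw
  simp only [List.nodup_cons, List.mem_cons, List.not_mem_nil, not_or] at hnd
  simp only [List.length_append, List.length_replicate, List.count_append, List.count_replicate,
    beq_iff_eq]
  grind

/-- By pigeonhole, two words `aⁿbⁿcⁿdⁿ` have exchangeable factors of different lengths that belong
to the same language of the system and avoid the same letter, `a` or `d`.  The exchange preserves
the number of occurrences of that letter but not the length. -/
theorem not_isContextFree_fourCounts {a b c d : T} (hnd : [a, b, c, d].Nodup) :
    ¬ (fourCounts a b c d).IsContextFree := by
  classical
  intro hcf
  obtain ⟨S, s, hS⟩ := exists_greibachSystem hcf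
  -- lengths between `4 ^ i` and `3 * 4 ^ i` are different for different `i`
  have key : ∀ i : ℕ, ∃ j u v y, u ++ v ++ y ∈ S.lang s ∧ v ∈ S.lang j ∧ 4 ^ i ≤ v.length ∧
      v.length ≤ 3 * 4 ^ i ∧ (a ∈ v → d ∉ v) ∧ ∀ v' ∈ S.lang j, u ++ v' ++ y ∈ S.lang s := by
    intro i
    have hpos : 0 < 4 ^ i := by positivity
    set w := List.replicate (3 * 4 ^ i) a ++ List.replicate (3 * 4 ^ i) b ++
      List.replicate (3 * 4 ^ i) c ++ List.replicate (3 * 4 ^ i) d with hwdef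
    have hlen : w.length = 12 * 4 ^ i := by simp [hwdef]; ring
    have hw : w ∈ S.lang s :=
      (hS w).2 ⟨⟨3 * 4 ^ i, by omega, rfl⟩, fun h => by rw [h] at hlen; simp at hlen⟩
    obtain ⟨j, u, v, y, he, hv, h₁, h₂, h₃⟩ :=
      exists_exchangeable_factor S (4 ^ i) hpos s w hw (by omega)
    exact ⟨j, u, v, y, he ▸ hw, hv, h₁, h₂,
      notMem_of_short_factor hnd he.symm (by omega), h₃⟩
  choose j u v y hw hv h₁ h₂ had hex using key
  obtain ⟨i, i', hne, heq⟩ := Finite.exists_ne_map_eq_of_infinite fun i => (j i, decide (a ∈ v i))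
  wlog hlt : i < i' generalizing i i'
  · exact this i' i hne.symm heq.symm (by omega)
  obtain ⟨hj, hmem⟩ := Prod.mk.inj heq
  rw [decide_eq_decide] at hmem
  have hlen : (v i).length < (v i').length := by
    have := Nat.pow_le_pow_right (n := 4) (by norm_num) (Nat.succ_le_of_lt hlt)
    have h3 := h₁ i'
    have h4 := h₂ i
    have : 0 < 4 ^ i := by positivity
    rw [Nat.succ_eq_add_one, pow_succ] at *
    omega
  have hmem₁ := length_eq_of_mem_fourCounts hnd ((hS _).1 (hw i)).1
  have hmem₂ := length_eq_of_mem_fourCounts hnd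
    ((hS _).1 (hex i (v i') (by rw [hj]; exact hv i'))).1
  simp only [List.length_append, List.count_append] at hmem₁ hmem₂
  by_cases ha : a ∈ v i
  · have e₁ := List.count_eq_zero.2 (had i ha)
    have e₂ := List.count_eq_zero.2 (had i' (hmem.1 ha))
    omega
  · have e₁ := List.count_eq_zero.2 ha
    have e₂ := List.count_eq_zero.2 (fun h => ha (hmem.2 h))
    omega

end NotContextFree

/-! ### Trees in first-child / right-sibling form -/

section Trees

variable {V : Type v} {T : Type u}

/-- Forests in first-child / right-sibling form: `node n l c s` is the node `n` with label `l`,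
forest of children `c` and forest of right siblings `s`. -/
inductive Tree (V : Type v) (T : Type u)
  | nil : Tree V T
  | node (n : ℕ) (l : V ⊕ T) (c s : Tree V T) : Tree V T

namespace Tree

/-- The labelled nodes. -/
def items : Tree V T → List (ℕ × (V ⊕ T))
  | nil => []
  | node n l c s => (n, l) :: (items c ++ items s)

/-- The nodes. -/
def ids : Tree V T → List ℕ
  | nil => []
  | node n _ c s => n :: (ids c ++ ids s)

/-- The first of the top-level nodes. -/
def top : Tree V T → Option ℕ
  | nil => none
  | node n _ _ _ => some n

@[simp] theorem top_nil : (nil : Tree V T).top = none := rfl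

@[simp] theorem top_node (n : ℕ) (l : V ⊕ T) (c s : Tree V T) : (node n l c s).top = some n := rfl

/-- The first-child relation. -/
def E : Tree V T → ℕ → ℕ → Prop
  | nil, _, _ => False
  | node n _ c s, m, k => (m = n ∧ c.top = some k) ∨ E c m k ∨ E s m k

/-- The right-sibling relation. -/
def F : Tree V T → ℕ → ℕ → Prop
  | nil, _, _ => False
  | node n _ c s, m, k => (m = n ∧ s.top = some k) ∨ F c m k ∨ F s m k

/-- The first top-level node, if there is one, is nonlexical. -/
def TopNonlex : Tree V T → Prop
  | nil => True
  | node _ l _ _ => ∃ A, l = .inl A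

/-- Lexemes have no children, and they are neither right siblings nor have any. -/
def WF : Tree V T → Prop
  | nil => True
  | node _ l c s => c.WF ∧ s.WF ∧ s.TopNonlex ∧ ∀ a, l = .inr a → c = nil ∧ s = nil

/-- Preorder traversal from left to right: every terminal node `n` with label `l` contributes
`leaf n l`, and the contribution of the children of a node with label `l` is enclosed between
`op l` and `cl l`. -/
def walk {α : Type*} (leaf : ℕ → V ⊕ T → List α) (op cl : V ⊕ T → List α) : Tree V T → List α
  | nil => []
  | node n l nil s => leaf n l ++ walk leaf op cl s
  | node _ l (node n' l' c' s') s =>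
      op l ++ walk leaf op cl (node n' l' c' s') ++ cl l ++ walk leaf op cl s

/-- The terminal nodes from left to right. -/
abbrev front (b : Tree V T) : List ℕ := b.walk (fun n _ => [n]) (fun _ => []) (fun _ => [])

/-- The labels of the terminal nodes from left to right. -/
abbrev frontLabels (b : Tree V T) : List (V ⊕ T) :=
  b.walk (fun _ l => [l]) (fun _ => []) (fun _ => [])

section walk

variable {α β : Type*} (leaf : ℕ → V ⊕ T → List α) (op cl : V ⊕ T → List α)

@[simp] theorem walk_nil : (nil : Tree V T).walk leaf op cl = [] := rfl

@[simp] theorem walk_leaf (n : ℕ) (l : V ⊕ T) (s : Tree V T) :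
    (node n l nil s).walk leaf op cl = leaf n l ++ s.walk leaf op cl := by rw [walk]

theorem walk_node (n : ℕ) (l : V ⊕ T) {c : Tree V T} (hc : c ≠ nil) (s : Tree V T) :
    (node n l c s).walk leaf op cl =
      op l ++ c.walk leaf op cl ++ cl l ++ s.walk leaf op cl := by
  cases c with
  | nil => exact absurd rfl hc
  | node n' l' c' s' => rw [walk]

theorem walk_flatMap (f : α → List β) (b : Tree V T) :
    (b.walk leaf op cl).flatMap f =
      b.walk (fun n l => (leaf n l).flatMap f) (fun l => (op l).flatMap f)
        (fun l => (cl l).flatMap f) := by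
  induction b with
  | nil => rfl
  | node n l c s ihc ihs =>
    by_cases hc : c = nil
    · subst hc; simp [ihs]
    · simp [walk_node _ _ _ _ _ hc, ihc, ihs]

end walk

theorem front_ne_nil {b : Tree V T} (hb : b ≠ nil) : b.front ≠ [] := by
  induction b with
  | nil => exact absurd rfl hb
  | node n l c s ihc ihs =>
    by_cases hc : c = nil
    · subst hc; simp [front]
    · simp [front, walk_node _ _ _ _ _ hc, ihc hc]

theorem items_map_fst (b : Tree V T) : b.items.map Prod.fst = b.ids := by
  induction b with
  | nil => rfl
  | node n l c s ihc ihs => simp [items, ids, ihc, ihs]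

theorem mem_ids {b : Tree V T} {n : ℕ} : n ∈ b.ids ↔ ∃ l, (n, l) ∈ b.items := by
  simp [← items_map_fst]

theorem top_mem {b : Tree V T} {k : ℕ} (h : b.top = some k) : k ∈ b.ids := by
  cases b with
  | nil => simp [top] at h
  | node => simp_all [top, ids]

theorem front_subset {b : Tree V T} {n : ℕ} (h : n ∈ b.front) : n ∈ b.ids := by
  induction b with
  | nil => simp [front] at h
  | node m l c s ihc ihs =>
    by_cases hc : c = nil
    · subst hc
      simp only [front, walk_leaf, List.singleton_append, List.mem_cons] at h
      simp only [ids, List.mem_cons, List.mem_append]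
      tauto
    · simp only [front, walk_node _ _ _ _ _ hc, List.nil_append, List.append_nil,
        List.mem_append] at h
      simp only [ids, List.mem_cons, List.mem_append]
      tauto

theorem front_nodup {b : Tree V T} (h : b.ids.Nodup) : b.front.Nodup := by
  induction b with
  | nil => simp
  | node m l c s ihc ihs =>
    simp only [ids, List.nodup_cons, List.mem_append, not_or, List.nodup_append] at h
    by_cases hc : c = nil
    · subst hc
      simp only [walk_leaf, List.singleton_append, List.nodup_cons]
      exact ⟨fun hm => h.1.2 (front_subset hm), ihs h.2.2.1⟩
    · simp only [walk_node _ _ _ _ _ hc, List.nil_append, List.append_nil, List.nodup_append]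
      exact ⟨ihc h.2.1, ihs h.2.2.1,
        fun a ha b hb => h.2.2.2 a (front_subset ha) b (front_subset hb)⟩

theorem E_mem {b : Tree V T} {m k : ℕ} (h : b.E m k) : m ∈ b.ids ∧ k ∈ b.ids := by
  induction b with
  | nil => exact h.elim
  | node n l c s ihc ihs =>
    simp only [ids, List.mem_cons, List.mem_append]
    rcases h with ⟨rfl, h⟩ | h | h
    · exact ⟨.inl rfl, .inr (.inl (top_mem h))⟩
    · have := ihc h; tauto
    · have := ihs h; tauto

theorem F_mem {b : Tree V T} {m k : ℕ} (h : b.F m k) : m ∈ b.ids ∧ k ∈ b.ids := by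
  induction b with
  | nil => exact h.elim
  | node n l c s ihc ihs =>
    simp only [ids, List.mem_cons, List.mem_append]
    rcases h with ⟨rfl, h⟩ | h | h
    · exact ⟨.inl rfl, .inr (.inr (top_mem h))⟩
    · have := ihc h; tauto
    · have := ihs h; tauto

/-- The edges of a tree, with `false` for a first-child and `true` for a right-sibling edge. -/
def edge (b : Tree V T) (i : Bool) (m k : ℕ) : Prop := bif i then b.F m k else b.E m k

theorem edge_mem {b : Tree V T} {i : Bool} {m k : ℕ} (h : b.edge i m k) :
    m ∈ b.ids ∧ k ∈ b.ids := by
  cases i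
  · exact E_mem h
  · exact F_mem h

theorem edge_node {n : ℕ} {l : V ⊕ T} {c s : Tree V T} {i : Bool} {m k : ℕ} :
    (node n l c s).edge i m k ↔
      (m = n ∧ (bif i then s.top = some k else c.top = some k)) ∨ c.edge i m k ∨ s.edge i m k := by
  cases i <;> rfl

/-- The nodes below the top node of a nonempty tree have a unique incoming edge, of one kind. -/
theorem edge_unique {b : Tree V T} (hb : b.ids.Nodup) {i i' : Bool} {m m' k : ℕ}
    (h : b.edge i m k) (h' : b.edge i' m' k) : i = i' ∧ m = m' ∧ b.top ≠ some k := by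
  induction b generalizing i i' m m' with
  | nil => cases i <;> exact h.elim
  | node n l c s ihc ihs =>
    simp only [ids, List.nodup_cons, List.mem_append, not_or, List.nodup_append] at hb
    obtain ⟨⟨hnc, hns⟩, hc, hs, hcs⟩ := hb
    have ic := fun i i' m m' => @ihc hc i i' m m'
    have is := fun i i' m m' => @ihs hs i i' m m'
    have hmem : k ∈ c.ids ∨ k ∈ s.ids := by
      rw [edge_node] at h
      rcases h with ⟨-, h⟩ | h | h
      · cases i
        · exact .inl (top_mem h)
        · exact .inr (top_mem h)
      · exact .inl (edge_mem h).2
      · exact .inr (edge_mem h).2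
    have hroot : (node n l c s).top ≠ some k := by
      simp only [top, ne_eq, Option.some.injEq]
      rintro rfl
      tauto
    rw [edge_node] at h h'
    have disj : k ∈ c.ids → k ∈ s.ids → False := fun h₁ h₂ => hcs k h₁ k h₂ rfl
    have hct := @top_mem _ _ c k
    have hst := @top_mem _ _ s k
    have hce := fun i m => @edge_mem _ _ c i m k
    have hse := fun i m => @edge_mem _ _ s i m k
    have hc' := fun i m (h : c.edge i m k) => (ic i i m m h h).2.2
    have hs' := fun i m (h : s.edge i m k) => (is i i m m h h).2.2
    refine ⟨?_, ?_, hroot⟩ <;> cases i <;> cases i' <;> simp only [cond_true, cond_false] at h h' <;>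
      grind

theorem edge_fun {b : Tree V T} (hb : b.ids.Nodup) {i : Bool} {m k k' : ℕ}
    (h : b.edge i m k) (h' : b.edge i m k') : k = k' := by
  induction b with
  | nil => cases i <;> exact h.elim
  | node n l c s ihc ihs =>
    simp only [ids, List.nodup_cons, List.mem_append, not_or, List.nodup_append] at hb
    obtain ⟨⟨hnc, hns⟩, hc, hs, hcs⟩ := hb
    have ic := fun h h' => ihc hc h h'
    have is := fun h h' => ihs hs h h'
    rw [edge_node] at h h'
    have disj : m ∈ c.ids → m ∈ s.ids → False := fun h₁ h₂ => hcs m h₁ m h₂ rfl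
    have hce := fun k => @edge_mem _ _ c i m k
    have hse := fun k => @edge_mem _ _ s i m k
    cases i <;> simp only [cond_true, cond_false] at h h' <;> grind

theorem E_source_nonlex {b : Tree V T} (hw : b.WF) {m k : ℕ} (h : b.E m k) :
    ∃ A, (m, .inl A) ∈ b.items := by
  induction b with
  | nil => exact h.elim
  | node n l c s ihc ihs =>
    simp only [items, List.mem_cons, List.mem_append]
    rcases h with ⟨rfl, h⟩ | h | h
    · rcases l with A | a
      · exact ⟨A, .inl rfl⟩
      · rw [(hw.2.2.2 a rfl).1] at h; simp [top] at h
    · obtain ⟨A, h⟩ := ihc hw.1 h; exact ⟨A, .inr (.inl h)⟩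
    · obtain ⟨A, h⟩ := ihs hw.2.1 h; exact ⟨A, .inr (.inr h)⟩

theorem TopNonlex.exists_mem {b : Tree V T} (h : b.TopNonlex) {k : ℕ} (hk : b.top = some k) :
    ∃ A, (k, .inl A) ∈ b.items := by
  cases b with
  | nil => simp [top] at hk
  | node n l c s =>
    obtain ⟨A, rfl⟩ := h
    simp only [top, Option.some.injEq] at hk
    exact ⟨A, by simp [items, hk]⟩

theorem F_nonlex {b : Tree V T} (hw : b.WF) {m k : ℕ} (h : b.F m k) :
    (∃ A, (m, .inl A) ∈ b.items) ∧ ∃ A, (k, .inl A) ∈ b.items := by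
  induction b with
  | nil => exact h.elim
  | node n l c s ihc ihs =>
    simp only [items, List.mem_cons, List.mem_append]
    rcases h with ⟨rfl, h⟩ | h | h
    · refine ⟨?_, ?_⟩
      · rcases l with A | a
        · exact ⟨A, .inl rfl⟩
        · rw [(hw.2.2.2 a rfl).2] at h; simp [top] at h
      · obtain ⟨A, hA⟩ := hw.2.2.1.exists_mem h
        exact ⟨A, .inr (.inr hA)⟩
    · obtain ⟨⟨A, hA⟩, B, hB⟩ := ihc hw.1 h
      exact ⟨⟨A, .inr (.inl hA)⟩, B, .inr (.inl hB)⟩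
    · obtain ⟨⟨A, hA⟩, B, hB⟩ := ihs hw.2.1 h
      exact ⟨⟨A, .inr (.inr hA)⟩, B, .inr (.inr hB)⟩

theorem reachable {b : Tree V T} {r n : ℕ} (hr : b.top = some r) (hn : n ∈ b.ids) :
    Relation.ReflTransGen (fun m k => b.E m k ∨ b.F m k) r n := by
  induction b generalizing r with
  | nil => simp [top] at hr
  | node m l c s ihc ihs =>
    simp only [top, Option.some.injEq] at hr
    subst hr
    simp only [ids, List.mem_cons, List.mem_append] at hn
    rcases hn with rfl | hn | hn
    · exact .refl
    · cases hc : c.top with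
      | none => cases c <;> simp_all [top, ids]
      | some x =>
        refine .head (.inl (.inl ⟨rfl, hc⟩)) (Relation.ReflTransGen.mono ?_ _ _ (ihc hc hn))
        intro x y h
        simp only [E, F]
        tauto
    · cases hs : s.top with
      | none => cases s <;> simp_all [top, ids]
      | some x =>
        refine .head (.inr (.inl ⟨rfl, hs⟩)) (Relation.ReflTransGen.mono ?_ _ _ (ihs hs hn))
        intro x y h
        simp only [E, F]
        tauto

theorem mem_front {b : Tree V T} (hb : b.ids.Nodup) {n : ℕ} :
    n ∈ b.front ↔ n ∈ b.ids ∧ ∀ k, ¬ b.E n k := by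
  induction b with
  | nil => simp [front, ids]
  | node m l c s ihc ihs =>
    simp only [ids, List.nodup_cons, List.mem_append, not_or, List.nodup_append] at hb
    obtain ⟨⟨hmc, hms⟩, hc, hs, hcs⟩ := hb
    have ic := ihc hc
    have is := ihs hs
    have disj : n ∈ c.ids → n ∈ s.ids → False := fun h₁ h₂ => hcs n h₁ n h₂ rfl
    have hce := fun k => @E_mem _ _ c n k
    have hse := fun k => @E_mem _ _ s n k
    by_cases hcn : c = nil
    · subst hcn
      simp only [walk_leaf, List.singleton_append, List.mem_cons, ids, List.nil_append, E, top,
        is] at *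
      grind
    · have htop : ∃ k, c.top = some k := by cases c <;> simp_all [top]
      simp only [walk_node _ _ _ _ _ hcn, List.nil_append, List.append_nil, List.mem_append, ids,
        List.mem_cons, E, ic, is]
      grind

end Tree

end Trees

/-! ### Parse graphs represented by trees -/

section Representation

variable {V : Type v} {T : Type u} {Γ : RawGraph V T} {b : Tree V T}

/-- The tree `b` represents the graph `Γ`. -/
structure Rep (Γ : RawGraph V T) (b : Tree V T) : Prop where
  nodup : b.ids.Nodup
  wf : b.WF
  topNonlex : b.TopNonlex
  top : b.top = some Γ.root
  mem_N : ∀ n, n ∈ Γ.N ↔ ∃ A, (n, .inl A) ∈ b.items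
  mem_L : ∀ n, n ∈ Γ.L ↔ ∃ a, (n, .inr a) ∈ b.items
  label : ∀ n l, (n, l) ∈ b.items → Γ.label n = l
  E : ∀ m n, Γ.E m n ↔ b.E m n
  F : ∀ m n, Γ.F m n ↔ b.F m n

theorem Rep.mem_nodes (h : Rep Γ b) {n : ℕ} : n ∈ Γ.nodes ↔ n ∈ b.ids := by
  rw [RawGraph.nodes, Finset.mem_union, h.mem_N, h.mem_L, Tree.mem_ids]
  constructor
  · rintro (⟨A, h⟩ | ⟨a, h⟩)
    · exact ⟨_, h⟩
    · exact ⟨_, h⟩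
  · rintro ⟨A | a, h⟩
    · exact .inl ⟨A, h⟩
    · exact .inr ⟨a, h⟩

theorem Rep.edge_iff (h : Rep Γ b) {m n : ℕ} : Γ.Edge m n ↔ ∃ i, b.edge i m n := by
  simp [RawGraph.Edge, h.E, h.F, Tree.edge]

theorem Rep.reachable (h : Rep Γ b) {n : ℕ} (hn : n ∈ b.ids) :
    Relation.ReflTransGen Γ.Edge Γ.root n := by
  refine Relation.ReflTransGen.mono (fun x y => ?_) _ _ (Tree.reachable h.top hn)
  exact fun h' => h'.imp (h.E x y).2 (h.F x y).2

theorem Rep.isParseGraph (h : Rep Γ b) : Γ.IsParseGraph where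
  disjoint := by
    rw [Finset.disjoint_left]
    intro n hN hL
    obtain ⟨A, hA⟩ := (h.mem_N n).1 hN
    obtain ⟨a, ha⟩ := (h.mem_L n).1 hL
    have := (h.label _ _ hA).symm.trans (h.label _ _ ha)
    simp at this
  root_mem := (h.mem_N _).2 (h.topNonlex.exists_mem h.top)
  label_N n hn := by
    obtain ⟨A, hA⟩ := (h.mem_N n).1 hn
    exact ⟨A, h.label _ _ hA⟩
  label_L n hn := by
    obtain ⟨A, hA⟩ := (h.mem_L n).1 hn
    exact ⟨A, h.label _ _ hA⟩
  E_dom m n hmn := by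
    rw [h.E] at hmn
    exact ⟨(h.mem_N _).2 (Tree.E_source_nonlex h.wf hmn), h.mem_nodes.2 (Tree.E_mem hmn).2⟩
  F_dom m n hmn := by
    rw [h.F] at hmn
    exact ⟨(h.mem_N _).2 (Tree.F_nonlex h.wf hmn).1, (h.mem_N _).2 (Tree.F_nonlex h.wf hmn).2⟩
  E_fun m n n' h₁ h₂ :=
    Tree.edge_fun h.nodup (i := false) ((h.E m n).1 h₁) ((h.E m n').1 h₂)
  F_fun m n n' h₁ h₂ :=
    Tree.edge_fun h.nodup (i := true) ((h.F m n).1 h₁) ((h.F m n').1 h₂)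
  E_F_disjoint m n := fun ⟨h₁, h₂⟩ => by
    have := (Tree.edge_unique h.nodup (i := false) (i' := true)
      ((h.E m n).1 h₁) ((h.F m n).1 h₂)).1
    cases this
  dominator n hn hr := by
    obtain hroot | ⟨m, -, hm⟩ := (h.reachable (h.mem_nodes.1 hn)).cases_tail
    · exact absurd hroot hr
    · refine ⟨m, hm, fun m' hm' => ?_⟩
      obtain ⟨i, hi⟩ := h.edge_iff.1 hm
      obtain ⟨i', hi'⟩ := h.edge_iff.1 hm'
      exact (Tree.edge_unique h.nodup hi' hi).2.1
  root_dominator m hm := by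
    obtain ⟨i, hi⟩ := h.edge_iff.1 hm
    exact (Tree.edge_unique h.nodup hi hi).2.2 h.top
  reachable n hn := h.reachable (h.mem_nodes.1 hn)

/-! ### The frontier of a represented graph -/

/-- Every node is a descendant of one of the top-level nodes.  The tree may be a subtree of the one
that represents the graph. -/
theorem exists_parent_chain (hE : ∀ m n, b.E m n → Γ.E m n) (hF : ∀ m n, b.F m n → Γ.F m n)
    {r m : ℕ} (hr : b.top = some r) (hm : m ∈ b.ids) :
    ∃ x, Relation.ReflTransGen Γ.Parent m x ∧ Relation.ReflTransGen Γ.F r x := by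
  induction b generalizing r with
  | nil => simp [Tree.top] at hr
  | node n l c s ihc ihs =>
    simp only [Tree.top, Option.some.injEq] at hr
    subst hr
    simp only [Tree.ids, List.mem_cons, List.mem_append] at hm
    rcases hm with rfl | hm | hm
    · exact ⟨m, .refl, .refl⟩
    · cases hc : c.top with
      | none => cases c <;> simp_all [Tree.top, Tree.ids]
      | some x =>
        obtain ⟨y, h₁, h₂⟩ := ihc (fun m n h => hE m n (.inr (.inl h)))
          (fun m n h => hF m n (.inr (.inl h))) hc hm
        exact ⟨n, h₁.tail ⟨x, h₂, hE _ _ (.inl ⟨rfl, hc⟩)⟩, .refl⟩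
    · cases hs : s.top with
      | none => cases s <;> simp_all [Tree.top, Tree.ids]
      | some x =>
        obtain ⟨y, h₁, h₂⟩ := ihs (fun m n h => hE m n (.inr (.inr h)))
          (fun m n h => hF m n (.inr (.inr h))) hs hm
        exact ⟨y, h₁, .head (hF _ _ (.inl ⟨rfl, hs⟩)) h₂⟩

/-- The leftmost leaf is reached from the first top-level node by first-child edges. -/
theorem exists_top_reaches_head (hE : ∀ m n, b.E m n → Γ.E m n) {n : ℕ}
    (hn : b.front.head? = some n) : ∃ r, b.top = some r ∧ Relation.ReflTransGen Γ.E r n := by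
  induction b with
  | nil => simp at hn
  | node m l c s ihc ihs =>
    refine ⟨m, rfl, ?_⟩
    by_cases hc : c = .nil
    · subst hc
      simp only [Tree.walk_leaf, List.singleton_append, List.head?_cons, Option.some.injEq] at hn
      rw [hn]
    · simp only [Tree.walk_node _ _ _ _ _ hc, List.nil_append, List.append_nil] at hn
      rw [List.head?_append_of_ne_nil _ (Tree.front_ne_nil hc)] at hn
      obtain ⟨r, hr, h⟩ := ihc (fun m n h => hE m n (.inr (.inl h))) hn
      exact .head (hE _ _ (.inl ⟨rfl, hr⟩)) h

theorem isChain_succ_front (hE : ∀ m n, b.E m n → Γ.E m n) (hF : ∀ m n, b.F m n → Γ.F m n) :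
    b.front.IsChain Γ.Succ := by
  induction b with
  | nil => simp
  | node m l c s ihc ihs =>
    have hEs : ∀ m n, s.E m n → Γ.E m n := fun m n h => hE m n (.inr (.inr h))
    have hs := ihs hEs (fun m n h => hF m n (.inr (.inr h)))
    by_cases hc : c = .nil
    · subst hc
      rw [Tree.front, Tree.walk_leaf, List.isChain_append]
      refine ⟨by simp, hs, fun x hx y hy => ?_⟩
      simp only [List.getLast?_singleton, Option.mem_def, Option.some.injEq] at hx
      subst hx
      obtain ⟨r, hr, h⟩ := exists_top_reaches_head hEs hy
      exact ⟨m, r, .refl, hF _ _ (.inl ⟨rfl, hr⟩), h⟩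
    · have hEc : ∀ m n, c.E m n → Γ.E m n := fun m n h => hE m n (.inr (.inl h))
      have hFc : ∀ m n, c.F m n → Γ.F m n := fun m n h => hF m n (.inr (.inl h))
      rw [Tree.front, Tree.walk_node _ _ _ _ _ hc, List.nil_append, List.append_nil,
        List.isChain_append]
      refine ⟨ihc hEc hFc, hs, fun x hx y hy => ?_⟩
      obtain ⟨r, hr, h⟩ := exists_top_reaches_head hEs hy
      obtain ⟨r', hr'⟩ : ∃ k, c.top = some k := by cases c <;> simp_all [Tree.top]
      obtain ⟨z, h₁, h₂⟩ := exists_parent_chain hEc hFc hr'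
        (Tree.front_subset (List.mem_of_getLast? hx))
      exact ⟨m, r, h₁.tail ⟨r', h₂, hE _ _ (.inl ⟨rfl, hr'⟩)⟩, hF _ _ (.inl ⟨rfl, hr⟩), h⟩

/-- The leaves below a node form an interval of the frontier.  For a tree whose frontier occupies
the positions from `k` on, `lo n` and `hi n` are the bounds of the interval of `n`, and `e n` is
the upper bound of the interval of the last right sibling of `n`. -/
theorem exists_positions (hb : b.ids.Nodup) (k : ℕ) :
    ∃ lo hi e : ℕ → ℕ, (∀ n, lo n < hi n ∧ hi n ≤ e n) ∧
      (∀ m n, b.E m n → lo m = lo n ∧ hi m = e n) ∧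
      (∀ m n, b.F m n → hi m = lo n ∧ e m = e n) ∧
      (∀ r, b.top = some r → lo r = k ∧ e r = k + b.front.length) ∧
      ∀ i n, b.front[i]? = some n → lo n = k + i ∧ hi n = k + i + 1 := by
  classical
  induction b generalizing k with
  | nil =>
    exact ⟨fun _ => 0, fun _ => 1, fun _ => 1, by simp, by simp [Tree.E], by simp [Tree.F],
      by simp [Tree.top], by simp⟩
  | node m l c s ihc ihs =>
    simp only [Tree.ids, List.nodup_cons, List.mem_append, not_or, List.nodup_append] at hb
    obtain ⟨⟨hmc, hms⟩, hc, hs, hcs⟩ := hb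
    obtain ⟨f, hf0, hf, hf1⟩ : ∃ f : List ℕ, 0 < f.length ∧
        (Tree.node m l c s).front = f ++ s.front ∧ (c = .nil ∧ f = [m] ∨ c ≠ .nil ∧ f = c.front) := by
      by_cases hcn : c = .nil
      · subst hcn; exact ⟨[m], by simp, by simp, .inl ⟨rfl, rfl⟩⟩
      · exact ⟨c.front, List.length_pos_iff.2 (Tree.front_ne_nil hcn),
          by simp [Tree.walk_node _ _ _ _ _ hcn], .inr ⟨hcn, rfl⟩⟩
    obtain ⟨lo₁, hi₁, e₁, a₁, E₁, F₁, t₁, p₁⟩ := ihc hc k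
    obtain ⟨lo₂, hi₂, e₂, a₂, E₂, F₂, t₂, p₂⟩ := ihs hs (k + f.length)
    have hEc := fun m n => @Tree.E_mem _ _ c m n
    have hEs := fun m n => @Tree.E_mem _ _ s m n
    have hFc := fun m n => @Tree.F_mem _ _ c m n
    have hFs := fun m n => @Tree.F_mem _ _ s m n
    have hTc := fun n => @Tree.top_mem _ _ c n
    have hTs := fun n => @Tree.top_mem _ _ s n
    have hfr : ∀ n ∈ c.front, n ∈ c.ids := fun n => Tree.front_subset
    have hfs : ∀ n ∈ s.front, n ∈ s.ids := fun n => Tree.front_subset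
    have hdis : ∀ n, n ∈ c.ids → n ∈ s.ids → False := fun n h₁ h₂ => hcs n h₁ n h₂ rfl
    have hs0 : s = .nil → s.front = [] := by rintro rfl; rfl
    refine ⟨fun n => if n = m then k else if n ∈ c.ids then lo₁ n else lo₂ n,
      fun n => if n = m then k + f.length else if n ∈ c.ids then hi₁ n else hi₂ n,
      fun n => if n = m then k + f.length + s.front.length else
        if n ∈ c.ids then e₁ n else e₂ n, ?_, ?_, ?_, ?_, ?_⟩
    · grind
    · rintro x n (⟨rfl, h⟩ | h | h)
      · have : c ≠ .nil := by rintro rfl; simp [Tree.top] at h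
        grind
      · grind
      · grind
    · rintro x n (⟨rfl, h⟩ | h | h)
      · grind
      · grind
      · grind
    · intro r hr
      simp only [Tree.top, Option.some.injEq] at hr
      subst hr
      rw [hf]
      simp [add_assoc]
    · intro i n hn
      rw [hf, List.getElem?_append] at hn
      split_ifs at hn with hi
      · rcases hf1 with ⟨-, rfl⟩ | ⟨-, rfl⟩
        · simp only [List.length_singleton, Nat.lt_one_iff] at hi
          subst hi
          simp at hn
          simp [hn]
        · have := p₁ i n hn
          have := hfr n (List.mem_of_getElem? hn)
          grind
      · have := p₂ _ n hn
        have := hfs n (List.mem_of_getElem? hn)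
        grind

/-- The graph of a tree has exactly one frontier, the list of leaves from left to right. -/
theorem Rep.isFrontier_iff (h : Rep Γ b) {w : List ℕ} : Γ.IsFrontier w ↔ w = b.front := by
  obtain ⟨lo, hi, e, ha, hE, hF, -, hp⟩ := exists_positions h.nodup 0
  simp only [zero_add] at hp
  have hpar : ∀ m p, Relation.ReflTransGen Γ.Parent m p → hi m ≤ hi p := by
    intro m p hmp
    induction hmp with
    | refl => rfl
    | tail _ hp' ih =>
      refine ih.trans ?_
      obtain ⟨c, hc, hpc⟩ := hp'
      rw [(hE _ _ ((h.E _ _).1 hpc)).2]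
      have : ∀ x, Relation.ReflTransGen Γ.F c x → e c = e x := by
        intro x hx
        induction hx with
        | refl => rfl
        | tail _ hx ih => exact ih.trans (hF _ _ ((h.F _ _).1 hx)).2
      rw [this _ hc]
      exact (ha _).2
  have hlo : ∀ m p, Relation.ReflTransGen Γ.E m p → lo m = lo p := by
    intro m p hmp
    induction hmp with
    | refl => rfl
    | tail _ hp' ih => exact ih.trans (hE _ _ ((h.E _ _).1 hp')).1
  have hsucc : ∀ m n, Γ.Succ m n → hi m ≤ lo n := by
    rintro m n ⟨x, y, hmx, hxy, hyn⟩
    rw [← hlo _ _ hyn, ← (hF _ _ ((h.F _ _).1 hxy)).1]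
    exact hpar _ _ hmx
  have hterm : ∀ n, n ∈ b.front ↔ Γ.IsTerminal n := by
    intro n
    rw [Tree.mem_front h.nodup, RawGraph.IsTerminal, h.mem_nodes]
    simp only [h.E]
  have hchain : b.front.IsChain Γ.ImmSucc := by
    have h₀ := isChain_succ_front (fun m n => (h.E m n).2) (fun m n => (h.F m n).2)
    rw [List.isChain_iff_getElem] at h₀ ⊢
    intro i hi'
    refine ⟨h₀ i hi', fun p h₁ h₂ => ?_⟩
    -- the interval of `p` would lie strictly between two adjacent positions
    have h₁ := hsucc _ _ h₁
    have h₂ := hsucc _ _ h₂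
    have e₁ := hp i _ (List.getElem?_eq_getElem (by omega))
    have e₂ := hp (i + 1) _ (List.getElem?_eq_getElem hi')
    have := ha p
    omega
  have hsorted : ∀ w : List ℕ, w.IsChain Γ.ImmSucc → w.Pairwise (fun m n => lo m < lo n) := by
    intro w hw
    have : w.IsChain (fun m n => lo m < lo n) :=
      hw.imp fun m n hmn => (ha m).1.trans_le (hsucc _ _ hmn.1)
    have : Trans (fun m n : ℕ => lo m < lo n) (fun m n => lo m < lo n) (fun m n => lo m < lo n) :=
      ⟨fun h₁ h₂ => lt_trans h₁ h₂⟩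
    exact List.IsChain.pairwise ‹_›
  constructor
  · rintro ⟨hnd, hmem, hw⟩
    refine List.Perm.eq_of_pairwise (fun a b _ _ h₁ h₂ => absurd (h₁.trans h₂) (lt_irrefl _))
      (hsorted w hw) (hsorted _ hchain) ?_
    rw [List.perm_ext_iff_of_nodup hnd (Tree.front_nodup h.nodup)]
    exact fun n => (hmem n).trans (hterm n).symm
  · rintro rfl
    exact ⟨Tree.front_nodup h.nodup, hterm, hchain⟩

theorem Tree.labels_front {b : Tree V T} {f : ℕ → V ⊕ T} (h : ∀ n l, (n, l) ∈ b.items → f n = l) :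
    b.front.map f = b.frontLabels := by
  induction b with
  | nil => rfl
  | node n l c s ihc ihs =>
    have hs := ihs fun n l hm => h n l (by simp [Tree.items, hm])
    by_cases hc : c = .nil
    · subst hc
      simp [hs, h n l (by simp [Tree.items])]
    · simp [Tree.walk_node _ _ _ _ _ hc, hs, ihc fun n l hm => h n l (by simp [Tree.items, hm])]

theorem Rep.labels_front (h : Rep Γ b) : b.front.map Γ.label = b.frontLabels :=
  Tree.labels_front h.label

/-! ### Graphs of trees, and renaming -/

/-- The graph represented by a tree.  The label `A` outside of the tree, and the root in case that
the tree is empty, are junk. -/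
def Tree.toGraph (A : V) (b : Tree V T) : RawGraph V T where
  N := (b.items.filterMap fun p => p.2.getLeft?.map fun _ => p.1).toFinset
  L := (b.items.filterMap fun p => p.2.getRight?.map fun _ => p.1).toFinset
  root := b.top.getD 0
  label n := (b.items.lookup n).getD (.inl A)
  E := b.E
  F := b.F

theorem lookup_eq_some_of_mem {β : Type*} {l : List (ℕ × β)} (h : (l.map Prod.fst).Nodup) {n : ℕ}
    {x : β} (hx : (n, x) ∈ l) : l.lookup n = some x := by
  induction l with
  | nil => simp at hx
  | cons p l ih =>
    obtain ⟨m, y⟩ := p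
    simp only [List.map_cons, List.nodup_cons] at h
    rcases List.mem_cons.1 hx with hx' | hx'
    · obtain ⟨rfl, rfl⟩ := Prod.mk.inj hx'
      simp [List.lookup]
    · have : n ≠ m := by
        rintro rfl
        exact h.1 (List.mem_map_of_mem (f := Prod.fst) hx')
      simp [List.lookup, beq_false_of_ne this, ih h.2 hx']

theorem Tree.rep_toGraph (A : V) {b : Tree V T} (hb : b.ids.Nodup) (hw : b.WF)
    (ht : b.TopNonlex) (hne : b ≠ .nil) : Rep (b.toGraph A) b where
  nodup := hb
  wf := hw
  topNonlex := ht
  top := by cases b <;> simp_all [Tree.toGraph, Tree.top]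
  mem_N n := by
    simp [Tree.toGraph, Sum.getLeft?_eq_some_iff]
  mem_L n := by
    simp [Tree.toGraph, Sum.getRight?_eq_some_iff]
  label n l h := by
    rw [Tree.toGraph]
    simp only
    rw [lookup_eq_some_of_mem (by rwa [Tree.items_map_fst]) h, Option.getD_some]
  E _ _ := .rfl
  F _ _ := .rfl

/-- Renaming the nodes of a tree. -/
def Tree.rename (f : ℕ → ℕ) : Tree V T → Tree V T
  | .nil => .nil
  | .node n l c s => .node (f n) l (c.rename f) (s.rename f)

namespace Tree

variable (f : Equiv.Perm ℕ) (b : Tree V T)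

theorem ids_rename : (b.rename f).ids = b.ids.map f := by
  induction b <;> simp_all [Tree.rename, Tree.ids]

theorem items_rename : (b.rename f).items = b.items.map (Prod.map f id) := by
  induction b <;> simp_all [Tree.rename, Tree.items]

theorem mem_items_rename {n : ℕ} {l : V ⊕ T} :
    (n, l) ∈ (b.rename f).items ↔ (f.symm n, l) ∈ b.items := by
  rw [items_rename]
  simp only [List.mem_map, Prod.exists, Prod.map_apply, id, Prod.mk.injEq]
  constructor
  · rintro ⟨m, l, h, rfl, rfl⟩; simpa using h
  · exact fun h => ⟨_, _, h, by simp, rfl⟩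

theorem top_rename : (b.rename f).top = b.top.map f := by
  cases b <;> rfl

theorem rename_eq_nil : b.rename f = .nil ↔ b = .nil := by
  cases b <;> simp [Tree.rename]

theorem topNonlex_rename : (b.rename f).TopNonlex ↔ b.TopNonlex := by
  cases b <;> rfl

theorem wf_rename : (b.rename f).WF ↔ b.WF := by
  induction b with
  | nil => rfl
  | node n l c s ihc ihs =>
    simp only [Tree.rename, Tree.WF, ihc, ihs, topNonlex_rename, rename_eq_nil]

theorem E_rename (m n : ℕ) : (b.rename f).E m n ↔ b.E (f.symm m) (f.symm n) := by
  induction b with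
  | nil => rfl
  | node k l c s ihc ihs =>
    simp only [Tree.rename, Tree.E, ihc, ihs, top_rename, Option.map_eq_some_iff,
      Equiv.symm_apply_eq]
    grind

theorem F_rename (m n : ℕ) : (b.rename f).F m n ↔ b.F (f.symm m) (f.symm n) := by
  induction b with
  | nil => rfl
  | node k l c s ihc ihs =>
    simp only [Tree.rename, Tree.F, ihc, ihs, top_rename, Option.map_eq_some_iff,
      Equiv.symm_apply_eq]
    grind

theorem walk_rename {α : Type*} (leaf : V ⊕ T → List α) (op cl : V ⊕ T → List α) :
    (b.rename f).walk (fun _ => leaf) op cl = b.walk (fun _ => leaf) op cl := by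
  induction b with
  | nil => rfl
  | node k l c s ihc ihs =>
    by_cases hc : c = .nil
    · subst hc; simp [Tree.rename, ihs]
    · rw [Tree.rename, walk_node _ _ _ _ _ ((rename_eq_nil f c).not.2 hc),
        walk_node _ _ _ _ _ hc, ihc, ihs]

end Tree

theorem Rep.rename (h : Rep Γ b) (f : Equiv.Perm ℕ) : Rep (Γ.rename f) (b.rename f) where
  nodup := by rw [Tree.ids_rename]; exact h.nodup.map f.injective
  wf := (Tree.wf_rename f b).2 h.wf
  topNonlex := (Tree.topNonlex_rename f b).2 h.topNonlex
  top := by rw [Tree.top_rename, h.top]; rfl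
  mem_N n := by
    simp [RawGraph.rename, Tree.mem_items_rename, ← h.mem_N]
  mem_L n := by
    simp [RawGraph.rename, Tree.mem_items_rename, ← h.mem_L]
  label n l hn := h.label _ _ ((Tree.mem_items_rename f b).1 hn)
  E m n := (h.E _ _).trans (Tree.E_rename f b m n).symm
  F m n := (h.F _ _).trans (Tree.F_rename f b m n).symm

/-- Two finite sets of nodes can be made disjoint by renaming one of them. -/
theorem exists_perm_disjoint (l l' : List ℕ) : ∃ f : Equiv.Perm ℕ, ∀ n ∈ l, f n ∉ l' := by
  obtain ⟨K, hK⟩ : ∃ K, ∀ n ∈ l ++ l', n < K := by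
    refine ⟨(l ++ l').sum + 1, fun n hn => Nat.lt_succ_of_le (List.le_sum_of_mem hn)⟩
  have hinv : Function.Involutive
      (fun n => if n < K then n + K else if n < 2 * K then n - K else n) := by
    intro n
    dsimp only
    split_ifs <;> omega
  refine ⟨hinv.toPerm, fun n hn hn' => ?_⟩
  have h₁ := hK n (List.mem_append_left _ hn)
  have h₂ := hK _ (List.mem_append_right _ hn')
  rw [Function.Involutive.coe_toPerm, if_pos h₁] at h₂
  omega

end Representation

/-! ### One-hole contexts and interpolation of trees -/

section Interpolation

variable {V : Type v} {T : Type u}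

/-- Trees with a hole in the place of a subtree (in the binary, first-child / right-sibling
sense). -/
inductive Ctx (V : Type v) (T : Type u)
  | hole : Ctx V T
  | child (n : ℕ) (l : V ⊕ T) (C : Ctx V T) (s : Tree V T) : Ctx V T
  | sib (n : ℕ) (l : V ⊕ T) (c : Tree V T) (C : Ctx V T) : Ctx V T

namespace Ctx

/-- Filling the hole. -/
def fill : Ctx V T → Tree V T → Tree V T
  | hole, b => b
  | child n l C s, b => .node n l (C.fill b) s
  | sib n l c C, b => .node n l c (C.fill b)

/-- The labelled nodes of a context. -/
def items : Ctx V T → List (ℕ × (V ⊕ T))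
  | hole => []
  | child n l C s => (n, l) :: (C.items ++ s.items)
  | sib n l c C => (n, l) :: (c.items ++ C.items)

/-- The first of the top-level nodes. -/
def top : Ctx V T → Option ℕ
  | hole => none
  | child n _ _ _ => some n
  | sib n _ _ _ => some n

/-- The first-child edges between nodes of a context. -/
def E : Ctx V T → ℕ → ℕ → Prop
  | hole, _, _ => False
  | child n _ C s, m, k => (m = n ∧ C.top = some k) ∨ C.E m k ∨ s.E m k
  | sib n _ c C, m, k => (m = n ∧ c.top = some k) ∨ c.E m k ∨ C.E m k

/-- The right-sibling edges between nodes of a context. -/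
def F : Ctx V T → ℕ → ℕ → Prop
  | hole, _, _ => False
  | child n _ C s, m, k => (m = n ∧ s.top = some k) ∨ C.F m k ∨ s.F m k
  | sib n _ c C, m, k => (m = n ∧ C.top = some k) ∨ c.F m k ∨ C.F m k

/-- The hole is the first child of the node `m`. -/
def HoleE : Ctx V T → ℕ → Prop
  | hole, _ => False
  | child n _ C _, m => (m = n ∧ C = hole) ∨ C.HoleE m
  | sib _ _ _ C, m => C.HoleE m

/-- The hole is the right sibling of the node `m`. -/
def HoleF : Ctx V T → ℕ → Prop
  | hole, _ => False
  | child _ _ C _, m => C.HoleF m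
  | sib n _ _ C, m => (m = n ∧ C = hole) ∨ C.HoleF m

variable (C : Ctx V T) (b : Tree V T)

theorem items_fill : (C.fill b).items.Perm (C.items ++ b.items) := by
  induction C with
  | hole => exact .refl _
  | child n l C s ih =>
    simp only [fill, items, Tree.items, List.cons_append, List.perm_cons]
    refine (ih.append_right _).trans ?_
    simp only [List.append_assoc]
    exact List.perm_append_comm.append_left _
  | sib n l c C ih =>
    simp only [fill, items, Tree.items, List.cons_append, List.perm_cons, List.append_assoc]
    exact ih.append_left _

theorem top_fill (k : ℕ) :
    (C.fill b).top = some k ↔ C.top = some k ∨ (C = hole ∧ b.top = some k) := by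
  cases C <;> simp [fill, top, Tree.top]

theorem E_fill (m k : ℕ) :
    (C.fill b).E m k ↔ C.E m k ∨ b.E m k ∨ (C.HoleE m ∧ b.top = some k) := by
  induction C with
  | hole => simp [fill, E, HoleE]
  | child n l C s ih => simp only [fill, E, Tree.E, HoleE, ih, top_fill]; tauto
  | sib n l c C ih => simp only [fill, E, Tree.E, HoleE, ih]; tauto

theorem F_fill (m k : ℕ) :
    (C.fill b).F m k ↔ C.F m k ∨ b.F m k ∨ (C.HoleF m ∧ b.top = some k) := by
  induction C with
  | hole => simp [fill, F, HoleF]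
  | child n l C s ih => simp only [fill, F, Tree.F, HoleF, ih]; tauto
  | sib n l c C ih => simp only [fill, F, Tree.F, HoleF, ih, top_fill]; tauto

variable {C b}

theorem mem_ids_fill {n : ℕ} : n ∈ (C.fill b).ids ↔ n ∈ C.items.map Prod.fst ∨ n ∈ b.ids := by
  rw [← Tree.items_map_fst, ((C.items_fill b).map Prod.fst).mem_iff, List.map_append,
    List.mem_append, Tree.items_map_fst]

theorem E_mem {m k : ℕ} (h : C.E m k) :
    m ∈ C.items.map Prod.fst ∧ k ∈ C.items.map Prod.fst := by
  simpa [mem_ids_fill, Tree.ids] using Tree.E_mem ((C.E_fill .nil m k).2 (.inl h))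

theorem F_mem {m k : ℕ} (h : C.F m k) :
    m ∈ C.items.map Prod.fst ∧ k ∈ C.items.map Prod.fst := by
  simpa [mem_ids_fill, Tree.ids] using Tree.F_mem ((C.F_fill .nil m k).2 (.inl h))

theorem HoleE.mem {m : ℕ} (h : C.HoleE m) : m ∈ C.items.map Prod.fst := by
  induction C with
  | hole => exact h.elim
  | child n l C s ih =>
    simp only [items, List.map_cons, List.map_append, List.mem_cons, List.mem_append]
    rcases h with ⟨rfl, -⟩ | h
    · exact .inl rfl
    · exact .inr (.inl (ih h))
  | sib n l c C ih =>
    simp only [items, List.map_cons, List.map_append, List.mem_cons, List.mem_append]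
    exact .inr (.inr (ih h))

theorem HoleF.mem {m : ℕ} (h : C.HoleF m) : m ∈ C.items.map Prod.fst := by
  induction C with
  | hole => exact h.elim
  | child n l C s ih =>
    simp only [items, List.map_cons, List.map_append, List.mem_cons, List.mem_append]
    exact .inr (.inl (ih h))
  | sib n l c C ih =>
    simp only [items, List.map_cons, List.map_append, List.mem_cons, List.mem_append]
    rcases h with ⟨rfl, -⟩ | h
    · exact .inl rfl
    · exact .inr (.inr (ih h))

theorem top_mem {k : ℕ} (h : C.top = some k) : k ∈ C.items.map Prod.fst := by
  cases C <;> simp_all [top, items]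

theorem fill_ne_nil (h : b ≠ .nil) : C.fill b ≠ .nil := by
  cases C <;> simp_all [fill]

theorem topNonlex_fill {b' : Tree V T} (h : (C.fill b).TopNonlex) (hb' : b'.TopNonlex) :
    (C.fill b').TopNonlex := by
  cases C
  · exact hb'
  · exact h
  · exact h

theorem wf_fill {b' : Tree V T} (hb : b ≠ .nil) (h : (C.fill b).WF) (hb' : b'.WF)
    (ht : b'.TopNonlex) : (C.fill b').WF := by
  induction C with
  | hole => exact hb'
  | child n l C s ih =>
    exact ⟨ih h.1, h.2.1, h.2.2.1, fun a ha => absurd (h.2.2.2 a ha).1 (fill_ne_nil hb)⟩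
  | sib n l c C ih =>
    exact ⟨h.1, ih h.2.1, topNonlex_fill h.2.2.1 ht,
      fun a ha => absurd (h.2.2.2 a ha).2 (fill_ne_nil hb)⟩

theorem wf_of_fill (h : (C.fill b).WF) : b.WF := by
  induction C with
  | hole => exact h
  | child n l C s ih => exact ih h.1
  | sib n l c C ih => exact ih h.2.1

/-- The part of a traversal before and after the hole does not depend on what fills the hole. -/
theorem exists_walk_fill {α : Type*} (leaf : ℕ → V ⊕ T → List α) (op cl : V ⊕ T → List α)
    (C : Ctx V T) : ∃ u v, ∀ b : Tree V T, b ≠ .nil →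
      (C.fill b).walk leaf op cl = u ++ b.walk leaf op cl ++ v := by
  induction C with
  | hole => exact ⟨[], [], by simp [fill]⟩
  | child n l C s ih =>
    obtain ⟨u, v, h⟩ := ih
    refine ⟨op l ++ u, v ++ cl l ++ s.walk leaf op cl, fun b hb => ?_⟩
    rw [fill, Tree.walk_node _ _ _ _ _ (fill_ne_nil hb), h b hb]
    simp
  | sib n l c C ih =>
    obtain ⟨u, v, h⟩ := ih
    by_cases hc : c = .nil
    · subst hc
      refine ⟨leaf n l ++ u, v, fun b hb => ?_⟩
      rw [fill, Tree.walk_leaf, h b hb]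
      simp
    · refine ⟨op l ++ c.walk leaf op cl ++ cl l ++ u, v, fun b hb => ?_⟩
      rw [fill, Tree.walk_node _ _ _ _ _ hc, h b hb]
      simp

/-- Every node of a tree determines a context. -/
theorem exists_fill_of_mem {b : Tree V T} {q : ℕ} {l : V ⊕ T} (h : (q, l) ∈ b.items) :
    ∃ (C : Ctx V T) (c s : Tree V T), b = C.fill (.node q l c s) := by
  induction b with
  | nil => simp [Tree.items] at h
  | node n l' c s ihc ihs =>
    simp only [Tree.items, List.mem_cons, List.mem_append, Prod.mk.injEq] at h
    rcases h with ⟨rfl, rfl⟩ | h | h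
    · exact ⟨.hole, c, s, rfl⟩
    · obtain ⟨C, c', s', rfl⟩ := ihc h
      exact ⟨.child n l' C s, c', s', rfl⟩
    · obtain ⟨C, c', s', rfl⟩ := ihs h
      exact ⟨.sib n l' c C, c', s', rfl⟩

end Ctx

variable {Γ₁ Γ₂ : RawGraph V T}

theorem RawGraph.IsParseGraph.not_isDownShift_root (h : Γ₂.IsParseGraph) :
    ¬ Γ₂.IsDownShift Γ₂.root := by
  rintro ⟨s, hs, hr⟩
  rcases hr.cases_tail with rfl | ⟨m, -, hm⟩
  · exact h.root_dominator _ (.inl hs)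
  · exact h.root_dominator _ hm

/-- The common part of the two interpolation lemmas below. -/
theorem Rep.interpolate_of_perm {b₁ b₂ b₃ : Tree V T} (h₁ : Rep Γ₁ b₁) (h₂ : Rep Γ₂ b₂)
    (hdis : Disjoint Γ₁.nodes Γ₂.nodes) {q t : ℕ} {A : V} {rest : List (ℕ × (V ⊕ T))}
    (hp₁ : b₁.items.Perm ((q, .inl A) :: rest)) (hp₃ : b₃.items.Perm (rest ++ b₂.items))
    (hwf : b₃.WF) (htn : b₃.TopNonlex)
    (htop : b₃.top = some (RawGraph.interpolate Γ₁ Γ₂ q t).root)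
    (hE : ∀ m n, (RawGraph.interpolate Γ₁ Γ₂ q t).E m n ↔ b₃.E m n)
    (hF : ∀ m n, (RawGraph.interpolate Γ₁ Γ₂ q t).F m n ↔ b₃.F m n) :
    Rep (RawGraph.interpolate Γ₁ Γ₂ q t) b₃ := by
  have hnd₁ : (q :: rest.map Prod.fst).Nodup := by
    have := h₁.nodup
    rw [← Tree.items_map_fst] at this
    exact (hp₁.map Prod.fst).nodup_iff.1 this
  rw [List.nodup_cons] at hnd₁
  have hids₁ : ∀ n ∈ rest.map Prod.fst, n ∈ b₁.ids := fun n hn => by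
    rw [← Tree.items_map_fst, (hp₁.map Prod.fst).mem_iff]
    exact .tail _ hn
  have hdis' : ∀ n ∈ b₁.ids, n ∉ b₂.ids := fun n hn hn' =>
    Finset.disjoint_left.1 hdis (h₁.mem_nodes.2 hn) (h₂.mem_nodes.2 hn')
  have hq : q ∈ b₁.ids := Tree.mem_ids.2 ⟨_, hp₁.mem_iff.2 (.head _)⟩
  have hrest : ∀ n l', (n, l') ∈ rest ↔ (n, l') ∈ b₁.items ∧ n ≠ q := by
    intro n l'
    rw [hp₁.mem_iff, List.mem_cons]
    constructor
    · intro h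
      refine ⟨.inr h, ?_⟩
      rintro rfl
      exact hnd₁.1 (List.mem_map_of_mem (f := Prod.fst) h)
    · rintro ⟨h | h, hne⟩
      · exact absurd (Prod.mk.inj h).1 hne
      · exact h
  refine ⟨?_, hwf, htn, htop, fun n => ?_, fun n => ?_, fun n l' hn => ?_, hE, hF⟩
  · rw [← Tree.items_map_fst, (hp₃.map Prod.fst).nodup_iff, List.map_append,
      List.nodup_append, Tree.items_map_fst]
    exact ⟨hnd₁.2, h₂.nodup, fun x hx y hy hxy => hdis' x (hids₁ x hx) (hxy ▸ hy)⟩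
  · simp only [RawGraph.interpolate, Finset.mem_union, Finset.mem_erase, h₁.mem_N, h₂.mem_N,
      hp₃.mem_iff, List.mem_append, hrest]
    grind
  · simp only [RawGraph.interpolate, Finset.mem_union, h₁.mem_L, h₂.mem_L,
      hp₃.mem_iff, List.mem_append, hrest]
    have hqn : ∀ n a, (n, .inr a) ∈ b₁.items → n ≠ q := by
      rintro n a ha rfl
      have := (h₁.label _ _ ha).symm.trans (h₁.label n _ (hp₁.mem_iff.2 (.head _)))
      simp at this
    grind
  · simp only [RawGraph.interpolate]
    rcases List.mem_append.1 (hp₃.mem_iff.1 hn) with h | h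
    · rw [if_neg, h₁.label _ _ ((hrest n l').1 h).1]
      rw [h₂.mem_nodes]
      exact hdis' n (hids₁ n (List.mem_map_of_mem (f := Prod.fst) h))
    · rw [if_pos (h₂.mem_nodes.2 (Tree.mem_ids.2 ⟨l', h⟩)), h₂.label _ _ h]

/-- Interpolation at a terminal node, the target being the root of the addendum. -/
theorem Rep.interpolate_leaf {C : Ctx V T} {s c₂ : Tree V T} {q r : ℕ} {A B : V}
    (h₁ : Rep Γ₁ (C.fill (.node q (.inl A) .nil s))) (h₂ : Rep Γ₂ (.node r (.inl B) c₂ .nil))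
    (hdis : Disjoint Γ₁.nodes Γ₂.nodes) :
    Rep (RawGraph.interpolate Γ₁ Γ₂ q r) (C.fill (.node r (.inl B) c₂ s)) := by
  have hr : Γ₂.root = r := by simpa [Tree.top] using h₂.top.symm
  have hdown : ¬ Γ₂.IsDownShift r := hr ▸ h₂.isParseGraph.not_isDownShift_root
  have hright : ¬ Γ₂.IsRightShift r := by
    rintro ⟨x, hx, -⟩
    rw [h₂.F] at hx
    rcases hx with ⟨-, h⟩ | h | h
    · simp [Tree.top] at h
    · have hmem := (Tree.F_mem h).1
      have := h₂.nodup
      rw [hr] at hmem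
      simp [Tree.ids, hmem] at this
    · exact h
  have hnd := h₁.nodup
  rw [← Tree.items_map_fst, ((C.items_fill _).map Prod.fst).nodup_iff, List.map_append,
    Tree.items_map_fst, Tree.ids, Tree.ids, List.nil_append, List.nodup_append,
    List.nodup_cons] at hnd
  obtain ⟨-, ⟨hqs, -⟩, hCs⟩ := hnd
  have hqC : q ∉ C.items.map Prod.fst := fun h => hCs q h q (.head _) rfl
  have hq₂ : q ∉ (Tree.node r (.inl B) c₂ .nil : Tree V T).ids := fun h =>
    Finset.disjoint_left.1 hdis (h₁.mem_nodes.2 (Ctx.mem_ids_fill.2 (.inr (by simp [Tree.ids]))))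
      (h₂.mem_nodes.2 h)
  simp only [Tree.ids, List.append_nil, List.mem_cons, not_or] at hq₂
  have w₁ := (Ctx.wf_of_fill h₁.wf)
  have ne : ∀ m ∈ C.items.map Prod.fst, m ≠ q := fun m hm h => hqC (h ▸ hm)
  have ne' : ∀ m ∈ s.ids, m ≠ q := fun m hm h => hqs (h ▸ hm)
  have ne₂ : ∀ m ∈ c₂.ids, m ≠ q := fun m hm h => hq₂.2 (h ▸ hm)
  refine h₁.interpolate_of_perm h₂ hdis (A := A) (rest := C.items ++ s.items) ?_ ?_ ?_ ?_ ?_ ?_ ?_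
  · refine (C.items_fill _).trans ?_
    simp only [Tree.items, List.nil_append]
    exact List.perm_middle
  · refine (C.items_fill _).trans ?_
    simp only [Tree.items, List.append_nil, List.append_assoc]
    refine List.Perm.append_left _ ?_
    rw [← List.cons_append]
    exact List.perm_append_comm
  · exact Ctx.wf_fill (by simp) h₁.wf ⟨h₂.wf.1, w₁.2.1, w₁.2.2.1, by simp⟩ ⟨B, rfl⟩
  · exact Ctx.topNonlex_fill h₁.topNonlex ⟨B, rfl⟩
  · have ht := h₁.top
    rw [Ctx.top_fill] at ht ⊢
    simp only [RawGraph.interpolate, hr, Tree.top, Option.some.injEq] at ht ⊢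
    rcases ht with ht | ⟨rfl, ht⟩
    · have := ne _ (Ctx.top_mem ht)
      rw [if_neg this.symm]
      exact .inl ht
    · simp [ht]
  · intro m n
    have a₁ := @Ctx.E_mem _ _ C m
    have a₂ := @Tree.E_mem _ _ s m
    have a₃ := @Tree.E_mem _ _ c₂ m n
    have a₄ := @Ctx.HoleE.mem _ _ C m
    have a₅ := @Tree.top_mem _ _ c₂ n
    have b₁ := @Ctx.E_mem _ _ C q n
    have b₂ := @Tree.E_mem _ _ s q n
    have b₄ := @Ctx.HoleE.mem _ _ C q
    simp only [RawGraph.interpolate, h₁.E, h₂.E, hr, Ctx.E_fill, Tree.E, Tree.top_nil, Tree.top_node,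
      Option.some.injEq, reduceCtorEq, hdown]
    grind
  · intro m n
    have a₁ := @Ctx.F_mem _ _ C m
    have a₂ := @Tree.F_mem _ _ s m
    have a₃ := @Tree.F_mem _ _ c₂ m n
    have a₄ := @Ctx.HoleF.mem _ _ C m
    have a₅ := fun k => @Tree.top_mem _ _ s k
    have b₁ := @Ctx.F_mem _ _ C q n
    have b₂ := @Tree.F_mem _ _ s q n
    have b₄ := @Ctx.HoleF.mem _ _ C q
    simp only [RawGraph.interpolate, h₁.F, h₂.F, hr, Ctx.F_fill, Tree.F, Tree.top_nil, Tree.top_node,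
      Option.some.injEq, reduceCtorEq, hright]
    grind

/-- A node below the root of a tree without further top-level nodes is reached by a path that
begins with a first-child edge. -/
theorem Rep.isDownShift {Γ : RawGraph V T} {r t : ℕ} {l : V ⊕ T} {c s : Tree V T}
    (h : Rep Γ (.node r l c s)) (ht : t ∈ c.ids) : Γ.IsDownShift t := by
  have hr : Γ.root = r := by simpa [Tree.top] using h.top.symm
  obtain ⟨x, hx⟩ : ∃ x, c.top = some x := by cases c <;> simp_all [Tree.top, Tree.ids]
  refine ⟨x, (h.E _ _).2 (.inl ⟨hr, hx⟩), ?_⟩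
  refine Relation.ReflTransGen.mono (fun y z hyz => ?_) _ _ (Tree.reachable hx ht)
  exact hyz.imp (fun h' => (h.E y z).2 (.inr (.inl h'))) (fun h' => (h.F y z).2 (.inr (.inl h')))

/-- Down-shift interpolation, the target being a terminal node of the addendum. -/
theorem Rep.interpolate_down {C D : Ctx V T} {c s st : Tree V T} {q r t : ℕ} {A B A' : V}
    (h₁ : Rep Γ₁ (C.fill (.node q (.inl A) c s)))
    (h₂ : Rep Γ₂ (.node r (.inl B) (D.fill (.node t (.inl A') .nil st)) .nil))
    (hdis : Disjoint Γ₁.nodes Γ₂.nodes) :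
    Rep (RawGraph.interpolate Γ₁ Γ₂ q t)
      (C.fill (.node r (.inl B) (D.fill (.node t (.inl A') c st)) s)) := by
  have hr : Γ₂.root = r := by simpa [Tree.top] using h₂.top.symm
  have htD : t ∈ (D.fill (.node t (.inl A') .nil st)).ids :=
    Ctx.mem_ids_fill.2 (.inr (by simp [Tree.ids]))
  have hdown : Γ₂.IsDownShift t := h₂.isDownShift htD
  have hnd₂ := h₂.nodup
  have hright : ¬ Γ₂.IsRightShift t := by
    rintro ⟨x, hx, -⟩
    rw [h₂.F] at hx
    rcases hx with ⟨-, h⟩ | h | h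
    · simp [Tree.top] at h
    · have hmem := (Tree.F_mem h).1
      rw [hr] at hmem
      simp [Tree.ids, hmem] at hnd₂
    · exact h
  have hnd := h₁.nodup
  rw [← Tree.items_map_fst, ((C.items_fill _).map Prod.fst).nodup_iff, List.map_append,
    Tree.items_map_fst, Tree.ids, List.nodup_append, List.nodup_cons, List.mem_append,
    not_or] at hnd
  obtain ⟨-, ⟨⟨hqc, hqs⟩, -⟩, hCs⟩ := hnd
  have hqC : q ∉ C.items.map Prod.fst := fun h => hCs q h q (.head _) rfl
  have hq₂ : q ∉ (Tree.node r (.inl B) (D.fill (.node t (.inl A') .nil st)) .nil : Tree V T).ids :=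
    fun h => Finset.disjoint_left.1 hdis
      (h₁.mem_nodes.2 (Ctx.mem_ids_fill.2 (.inr (by simp [Tree.ids])))) (h₂.mem_nodes.2 h)
  simp only [Tree.ids, List.append_nil, List.mem_cons, not_or, Ctx.mem_ids_fill,
    List.nil_append] at hq₂
  have w₁ := Ctx.wf_of_fill h₁.wf
  have w₂ := Ctx.wf_of_fill h₂.wf.1
  have ne : ∀ m ∈ C.items.map Prod.fst, m ≠ q := fun m hm h => hqC (h ▸ hm)
  have nec : ∀ m ∈ c.ids, m ≠ q := fun m hm h => hqc (h ▸ hm)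
  have nes : ∀ m ∈ s.ids, m ≠ q := fun m hm h => hqs (h ▸ hm)
  have neD : ∀ m ∈ D.items.map Prod.fst, m ≠ q := fun m hm h => hq₂.2.1 (h ▸ hm)
  have nest : ∀ m ∈ st.ids, m ≠ q := fun m hm h => hq₂.2.2.2 (h ▸ hm)
  have net := hq₂.2.2.1
  have neDt : ∀ m, (D.fill (.node t (.inl A') .nil st)).top = some m → m ≠ q := by
    intro m hm
    rcases (D.top_fill _ m).1 hm with h | ⟨-, h⟩
    · exact neD m (Ctx.top_mem h)
    · simp only [Tree.top, Option.some.injEq] at h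
      exact h ▸ fun h' => net h'.symm
  have htop : ∀ m, (D.fill (.node t (.inl A') c st)).top = some m ↔
      (D.fill (.node t (.inl A') .nil st)).top = some m := by
    intro m
    rw [Ctx.top_fill, Ctx.top_fill]
    rfl
  refine h₁.interpolate_of_perm h₂ hdis (A := A) (rest := C.items ++ (c.items ++ s.items)) ?_ ?_ ?_ ?_ ?_
    ?_ ?_
  · refine (C.items_fill _).trans ?_
    simp only [Tree.items]
    exact List.perm_middle
  · refine (C.items_fill _).trans ?_
    simp only [Tree.items, List.append_nil, List.append_assoc]
    refine List.Perm.append_left _ ?_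
    rw [← Multiset.coe_eq_coe]
    have e₁ := Multiset.coe_eq_coe.2 (D.items_fill (.node t (.inl A') c st))
    have e₂ := Multiset.coe_eq_coe.2 (D.items_fill (.node t (.inl A') .nil st))
    simp only [Tree.items, ← Multiset.coe_add, ← Multiset.cons_coe, List.nil_append] at e₁ e₂ ⊢
    rw [e₁, e₂]
    simp only [← Multiset.singleton_add]
    abel
  · exact Ctx.wf_fill (by simp) h₁.wf ⟨Ctx.wf_fill (by simp) h₂.wf.1
      ⟨w₁.1, w₂.2.1, w₂.2.2.1, by simp⟩ ⟨A', rfl⟩, w₁.2.1, w₁.2.2.1, by simp⟩ ⟨B, rfl⟩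
  · exact Ctx.topNonlex_fill h₁.topNonlex ⟨B, rfl⟩
  · have ht := h₁.top
    rw [Ctx.top_fill] at ht ⊢
    simp only [RawGraph.interpolate, hr, Tree.top, Option.some.injEq] at ht ⊢
    rcases ht with ht | ⟨rfl, ht⟩
    · have := ne _ (Ctx.top_mem ht)
      rw [if_neg this.symm]
      exact .inl ht
    · simp [ht]
  · intro m n
    have a₁ := @Ctx.E_mem _ _ C m
    have a₂ := @Tree.E_mem _ _ s m
    have a₃ := @Tree.E_mem _ _ c m
    have a₄ := @Ctx.HoleE.mem _ _ C m
    have a₅ := fun k => @Tree.top_mem _ _ c k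
    have a₆ := @Tree.E_mem _ _ st m n
    have a₇ := @Ctx.HoleE.mem _ _ D m
    have a₈ := @Ctx.E_mem _ _ D m n
    have b₁ := @Ctx.E_mem _ _ C q n
    have b₂ := @Tree.E_mem _ _ s q n
    have b₃ := @Tree.E_mem _ _ c q n
    have b₄ := @Ctx.HoleE.mem _ _ C q
    have b₅ := neDt n
    have b₆ := htop n
    simp only [RawGraph.interpolate, h₁.E, h₂.E, hr, Tree.E, Ctx.E_fill, Tree.top_nil, Tree.top_node,
      Option.some.injEq, reduceCtorEq, hdown]
    clear hdown hright hnd₂ w₁ w₂ htop neDt hdis h₁ h₂ hCs htD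
    grind
  · intro m n
    have a₁ := @Ctx.F_mem _ _ C m
    have a₂ := @Tree.F_mem _ _ s m
    have a₃ := @Tree.F_mem _ _ c m
    have a₄ := @Ctx.HoleF.mem _ _ C m
    have a₅ := fun k => @Tree.top_mem _ _ s k
    have a₆ := @Tree.F_mem _ _ st m n
    have a₇ := @Ctx.HoleF.mem _ _ D m
    have a₈ := @Ctx.F_mem _ _ D m n
    have b₁ := @Ctx.F_mem _ _ C q n
    have b₂ := @Tree.F_mem _ _ s q n
    have b₃ := @Tree.F_mem _ _ c q n
    have b₄ := @Ctx.HoleF.mem _ _ C q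
    have b₅ := @Tree.top_mem _ _ st n
    simp only [RawGraph.interpolate, h₁.F, h₂.F, hr, Tree.F, Ctx.F_fill, Tree.top_nil, Tree.top_node,
      Option.some.injEq, reduceCtorEq, hright]
    clear hdown hright hnd₂ w₁ w₂ htop neDt hdis h₁ h₂ hCs htD
    grind

/-- An anchor with a child cannot be replaced by a root with a child, if the target is that root:
the root would get two first children. -/
theorem child_eq_nil_of_rep_interpolate {C : Ctx V T} {c s c₂ s₂ : Tree V T} {q r : ℕ} {l l' : V ⊕ T}
    (h₁ : Rep Γ₁ (C.fill (.node q l c s))) (h₂ : Rep Γ₂ (.node r l' c₂ s₂)) (hc₂ : c₂ ≠ .nil)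
    (hdis : Disjoint Γ₁.nodes Γ₂.nodes) (h₃ : (RawGraph.interpolate Γ₁ Γ₂ q r).IsParseGraph) :
    c = .nil := by
  by_contra hc
  obtain ⟨x, hx⟩ : ∃ x, c.top = some x := by cases c <;> simp_all [Tree.top]
  obtain ⟨y, hy⟩ : ∃ y, c₂.top = some y := by cases c₂ <;> simp_all [Tree.top]
  have hr : Γ₂.root = r := by simpa [Tree.top] using h₂.top.symm
  have hdown : ¬ Γ₂.IsDownShift r := hr ▸ h₂.isParseGraph.not_isDownShift_root
  have hqx : Γ₁.E q x := (h₁.E _ _).2 ((C.E_fill _ _ _).2 (.inr (.inl (.inl ⟨rfl, hx⟩))))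
  have hry : Γ₂.E r y := (h₂.E _ _).2 (.inl ⟨rfl, hy⟩)
  have hmem₁ : q ∈ Γ₁.nodes ∧ x ∈ Γ₁.nodes := by
    rw [h₁.mem_nodes, h₁.mem_nodes]; exact Tree.E_mem ((h₁.E _ _).1 hqx)
  have hmem₂ : r ∈ Γ₂.nodes ∧ y ∈ Γ₂.nodes := by
    rw [h₂.mem_nodes, h₂.mem_nodes]; exact Tree.E_mem ((h₂.E _ _).1 hry)
  have hdis := Finset.disjoint_left.1 hdis
  have := h₃.E_fun r x y (.inr (.inr ⟨hqx, .inr ⟨hdown, hr.symm⟩⟩))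
    (.inl ⟨.inr hry, fun h => hdis hmem₁.1 (h ▸ hmem₂.1), fun h => hdis hmem₁.1 (h ▸ hmem₂.2)⟩)
  exact hdis hmem₁.2 (this ▸ hmem₂.2)

end Interpolation

/-! ### Rules given by trees, and their moves -/

section Moves

variable {V : Type v} {T : Type u} {Γ : RawGraph V T} {b : Tree V T}

theorem rep_toGraph_node (B : V) {c : Tree V T} (hnd : (0 :: c.ids).Nodup) (hwf : c.WF) :
    Rep ((Tree.node 0 (.inl B) c .nil).toGraph B) (.node 0 (.inl B) c .nil) :=
  Tree.rep_toGraph B (by simpa [Tree.ids] using hnd) ⟨hwf, trivial, trivial, by simp⟩ ⟨B, rfl⟩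
    (by simp)

/-- The rule whose addendum is the graph of the tree with root `0`, labelled `B`, and forest of
children `c`. -/
def treeRule (A B : V) (c : Tree V T) (t : ℕ) (hnd : (0 :: c.ids).Nodup) (hwf : c.WF)
    (ht : t ∈ 0 :: c.ids) : Rule V T where
  pattern := A
  addendum := (Tree.node 0 (.inl B) c .nil).toGraph B
  target := t
  isParseGraph := (rep_toGraph_node B hnd hwf).isParseGraph
  target_mem := (rep_toGraph_node B hnd hwf).mem_nodes.2 (by simpa [Tree.ids] using ht)

theorem rep_single (S : V) : Rep (RawGraph.single S : RawGraph V T) (.node 0 (.inl S) .nil .nil) where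
  nodup := by simp [Tree.ids]
  wf := ⟨trivial, trivial, trivial, by simp⟩
  topNonlex := ⟨S, rfl⟩
  top := rfl
  mem_N n := by simp [RawGraph.single, Tree.items]
  mem_L n := by simp [RawGraph.single, Tree.items]
  label n l h := by
    simp only [Tree.items, List.append_nil, List.mem_singleton, Prod.mk.injEq] at h
    exact h.2.symm
  E m n := by simp [RawGraph.single, Tree.E]
  F m n := by simp [RawGraph.single, Tree.F]

theorem Rep.mem_items_label (h : Rep Γ b) {n : ℕ} (hn : n ∈ b.ids) : (n, Γ.label n) ∈ b.items := by
  obtain ⟨l, hl⟩ := Tree.mem_ids.1 hn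
  rwa [h.label _ _ hl]

theorem Rep.forall_mem_N (h : Rep Γ b) {l : List ℕ} (hl : ∀ n ∈ l, n ∈ b.ids) {α : List V}
    (hα : l.map Γ.label = α.map .inl) : ∀ n ∈ l, n ∈ Γ.N := by
  intro n hn
  have : Γ.label n ∈ α.map Sum.inl := hα ▸ List.mem_map_of_mem hn
  obtain ⟨A, -, hA⟩ := List.mem_map.1 this
  exact (h.mem_N n).2 ⟨A, hA ▸ h.mem_items_label (hl n hn)⟩

theorem Rep.forall_mem_L (h : Rep Γ b) {l : List ℕ} (hl : ∀ n ∈ l, n ∈ b.ids) {α : List T}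
    (hα : l.map Γ.label = α.map .inr) : ∀ n ∈ l, n ∈ Γ.L := by
  intro n hn
  have : Γ.label n ∈ α.map Sum.inr := hα ▸ List.mem_map_of_mem hn
  obtain ⟨A, -, hA⟩ := List.mem_map.1 this
  exact (h.mem_L n).2 ⟨A, hA ▸ h.mem_items_label (hl n hn)⟩

theorem Rep.exists_anchor (h : Rep Γ b) {q : ℕ} (hq : q ∈ Γ.N) {A : V} (hA : Γ.label q = .inl A) :
    ∃ C c s, b = Ctx.fill C (.node q (.inl A) c s) := by
  obtain ⟨A', hA'⟩ := (h.mem_N q).1 hq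
  have : A' = A := by simpa using (h.label _ _ hA').symm.trans hA
  exact Ctx.exists_fill_of_mem (this ▸ hA')

theorem interpolate_label_right {Γ₁ Γ₂ : RawGraph V T} {q t n : ℕ}
    (hn : n ∈ Γ₂.nodes) :
    (RawGraph.interpolate Γ₁ Γ₂ q t).label n = Γ₂.label n :=
  if_pos hn

theorem interpolate_label_left {Γ₁ Γ₂ : RawGraph V T} {q t n : ℕ}
    (hdis : Disjoint Γ₁.nodes Γ₂.nodes) (hn : n ∈ Γ₁.nodes) :
    (RawGraph.interpolate Γ₁ Γ₂ q t).label n = Γ₁.label n :=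
  if_neg (Finset.disjoint_left.1 hdis hn)

variable {G : GIG T}

/-- The effect of a move by an `ε`-shift rule on traversals. -/
theorem exists_rep_of_interpolationDefined_root {c₂ : Tree V T}
    (h : Rep Γ b) {ρ : Rule V T} {r : ℕ} {B : V}
    (h₂ : Rep ρ.addendum (.node r (.inl B) c₂ .nil)) (hc₂ : c₂ ≠ .nil) (ht : ρ.target = r)
    {f : Equiv.Perm ℕ} {q : ℕ} (hq : Γ.label q = .inl ρ.pattern)
    (hdef : RawGraph.InterpolationDefined Γ (ρ.addendum.rename f) q (f ρ.target))
    {α : Type*} (leaf op cl : V ⊕ T → List α) :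
    ∃ b', Rep (RawGraph.interpolate Γ (ρ.addendum.rename f) q (f ρ.target)) b' ∧
      ∃ u v, b.walk (fun _ => leaf) op cl = u ++ leaf (.inl ρ.pattern) ++ v ∧
        b'.walk (fun _ => leaf) op cl =
          u ++ (op (.inl B) ++ c₂.walk (fun _ => leaf) op cl ++ cl (.inl B)) ++ v := by
  obtain ⟨C, c, s, rfl⟩ := h.exists_anchor hdef.anchor_mem hq
  have h₂' := h₂.rename f
  subst ht
  have hc₂' : c₂.rename f ≠ .nil := (Tree.rename_eq_nil f c₂).not.2 hc₂
  obtain rfl := child_eq_nil_of_rep_interpolate h h₂' hc₂' hdef.disjunction hdef.result_graph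
  refine ⟨_, h.interpolate_leaf h₂' hdef.disjunction, ?_⟩
  obtain ⟨u, v, huv⟩ := C.exists_walk_fill (fun _ => leaf) op cl
  refine ⟨u, s.walk (fun _ => leaf) op cl ++ v, ?_, ?_⟩
  · rw [huv _ (by simp)]
    simp
  · rw [huv _ (by simp), Tree.walk_node _ _ _ _ _ hc₂', Tree.walk_rename]
    simp

/-- Interpolation is defined when it scans the first nonlexical terminal node. -/
theorem interpolationDefined_of_rep {Γ₁ Γ₂ : RawGraph V T} {b₁ b₂ b₃ : Tree V T} {q t : ℕ}
    (h₁ : Rep Γ₁ b₁) (h₂ : Rep Γ₂ b₂) (h₃ : Rep (RawGraph.interpolate Γ₁ Γ₂ q t) b₃)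
    (hq : q ∈ b₁.ids) {A : V} (hA : Γ₁.label q = .inl A) (ht : t ∈ b₂.ids)
    (hdis : Disjoint Γ₁.nodes Γ₂.nodes) (hcard : Γ₂.L.card = 1)
    {x α β ζ : List ℕ} {ν : ℕ} {x' : List T} {α' β' : List V} {a : T}
    (e₁ : b₁.front = x ++ α) (hx : x.map Γ₁.label = x'.map .inr)
    (hα : α.map Γ₁.label = α'.map .inl) (e₂ : b₂.front = ν :: β) (hν : Γ₂.label ν = .inr a)
    (hβ : β.map Γ₂.label = β'.map .inl) (e₃ : b₃.front = x ++ ν :: ζ) :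
    RawGraph.InterpolationDefined Γ₁ Γ₂ q t where
  context_graph := h₁.isParseGraph
  addendum_graph := h₂.isParseGraph
  anchor_mem := (h₁.mem_N q).2 ⟨A, hA ▸ h₁.mem_items_label hq⟩
  target_mem := h₂.mem_nodes.2 ht
  result_graph := h₃.isParseGraph
  disjunction := hdis
  lexicalization := hcard
  frontier := by
    have s₁ : ∀ n ∈ x ++ α, n ∈ b₁.ids := fun n hn => Tree.front_subset (e₁ ▸ hn)
    have s₂ : ∀ n ∈ ν :: β, n ∈ b₂.ids := fun n hn => Tree.front_subset (e₂ ▸ hn)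
    refine ⟨x, α, [], β, ζ, ν, h₁.isFrontier_iff.2 e₁.symm,
      h₁.forall_mem_L (fun n hn => s₁ n (List.mem_append_left _ hn)) hx,
      h₁.forall_mem_N (fun n hn => s₁ n (List.mem_append_right _ hn)) hα,
      h₂.isFrontier_iff.2 e₂.symm,
      (h₂.mem_L ν).2 ⟨a, hν ▸ h₂.mem_items_label (s₂ ν (.head _))⟩, by simp,
      h₂.forall_mem_N (fun n hn => s₂ n (.tail _ hn)) hβ, h₃.isFrontier_iff.2 e₃.symm⟩

theorem exists_disjoint_rename {Γ₁ Γ₂ : RawGraph V T} {b₁ b₂ : Tree V T} (h₁ : Rep Γ₁ b₁)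
    (h₂ : Rep Γ₂ b₂) : ∃ f : Equiv.Perm ℕ, Disjoint Γ₁.nodes (Γ₂.rename f).nodes := by
  obtain ⟨f, hf⟩ := exists_perm_disjoint b₂.ids b₁.ids
  refine ⟨f, Finset.disjoint_right.2 fun n hn hn' => ?_⟩
  rw [(h₂.rename f).mem_nodes, Tree.ids_rename] at hn
  obtain ⟨m, hm, rfl⟩ := List.mem_map.1 hn
  exact hf m hm (h₁.mem_nodes.1 hn')

/-- A graph whose first nonlexical terminal node is labelled `A` admits a move by any `ε`-shift
rule with the context pattern `A`. -/
theorem exists_step_root {Γ : RawGraph G.V T} {b c₂ : Tree G.V T} (h : Rep Γ b)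
    {ρ : Rule G.V T} (hρ : ρ ∈ G.rules) {r ν₀ : ℕ} {B : G.V} {x : List T} {α β : List G.V} {a : T}
    (h₂ : Rep ρ.addendum (.node r (.inl B) c₂ .nil)) (ht : ρ.target = r)
    (hL : ρ.addendum.L = {ν₀}) (hc₂ : c₂.frontLabels = .inr a :: β.map .inl)
    (hfl : b.frontLabels = x.map .inr ++ .inl ρ.pattern :: α.map .inl) (w : List T) :
    ∃ Γ' b', G.Step (Γ, a :: w) (Γ', w) ∧ Rep Γ' b' ∧
      b'.frontLabels = (x ++ [a]).map .inr ++ (β ++ α).map .inl ∧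
      ∃ (C : Ctx G.V T) (s : Tree G.V T) (q : ℕ) (f : Equiv.Perm ℕ),
        b = C.fill (.node q (.inl ρ.pattern) .nil s) ∧
        b' = C.fill (.node (f r) (.inl B) (c₂.rename f) s) := by
  subst ht
  obtain ⟨f, hdis⟩ := exists_disjoint_rename h h₂
  have h₂' := h₂.rename f
  have hnil : c₂ ≠ .nil := by rintro rfl; simp at hc₂
  have hnil' : c₂.rename f ≠ .nil := (Tree.rename_eq_nil f c₂).not.2 hnil
  have hf := h.labels_front
  rw [hfl] at hf
  obtain ⟨xn, l, hxl, hxn, hl⟩ := List.map_eq_append_iff.1 hf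
  obtain ⟨q, αn, rfl, hq, hαn⟩ := List.map_eq_cons_iff.1 hl
  have hqf : q ∈ b.front := hxl ▸ List.mem_append_right _ (.head _)
  have hqi := Tree.front_subset hqf
  obtain ⟨C, c, s, rfl⟩ := Ctx.exists_fill_of_mem (hq ▸ h.mem_items_label hqi)
  -- the anchor is a terminal node
  obtain rfl : c = .nil := by
    by_contra hc
    obtain ⟨k, hk⟩ : ∃ k, c.top = some k := by cases c <;> simp_all [Tree.top]
    exact ((Tree.mem_front h.nodup).1 hqf).2 k
      ((C.E_fill _ _ _).2 (.inr (.inl (.inl ⟨rfl, hk⟩))))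
  have h₃ := h.interpolate_leaf h₂' hdis
  obtain ⟨u, v, huv⟩ := C.exists_walk_fill (fun n _ => [n]) (fun _ => []) (fun _ => [])
  have e₁ := huv (.node q (.inl ρ.pattern) .nil s) (by simp)
  have e₃ := huv (.node (f ρ.target) (.inl B) (c₂.rename f) s) (by simp)
  rw [Tree.walk_node _ _ _ _ _ hnil'] at e₃
  rw [Tree.walk_leaf, List.singleton_append, List.append_assoc, List.cons_append] at e₁
  have hnd := Tree.front_nodup h.nodup
  -- the part of the frontier before the anchor consists of the lexemes
  have hxu : xn = u ∧ q = q ∧ αn = s.front ++ v := by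
    have hnd' := hnd
    rw [hxl] at hnd'
    refine (List.append_cons_inj_of_notMem ?_ ?_).1 (hxl.symm.trans e₁)
    · exact fun hm => (List.nodup_append.1 hnd').2.2 q hm q (.head _) rfl
    · exact (List.nodup_cons.1 (List.nodup_append.1 hnd').2.1).1
  obtain ⟨rfl, -, rfl⟩ := hxu
  have hcl : (c₂.rename f).front.map (ρ.addendum.rename f).label = .inr a :: β.map .inl := by
    have := h₂'.labels_front
    rw [Tree.rename, Tree.front, Tree.frontLabels, Tree.walk_node _ _ _ _ _ hnil',
      Tree.walk_node _ _ _ _ _ hnil', Tree.walk_rename] at this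
    simpa [hc₂, Tree.rename] using this
  obtain ⟨ν, βn, hνβ, hν, hβn⟩ := List.map_eq_cons_iff.1 hcl
  rw [Tree.front] at hνβ
  have e₂ : (Tree.rename f (.node ρ.target (.inl B) c₂ .nil)).front = ν :: βn := by
    rw [Tree.rename, Tree.front, Tree.walk_node _ _ _ _ _ hnil', hνβ]
    simp [Tree.rename]
  have hνi : ν ∈ (Tree.rename f (.node ρ.target (.inl B) c₂ .nil)).ids :=
    Tree.front_subset (e₂ ▸ .head _)
  rw [hνβ] at e₃
  simp only [List.nil_append, List.append_nil, List.append_assoc, List.cons_append] at e₃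
  have hdef := interpolationDefined_of_rep h h₂' h₃ hqi hq (t := f ρ.target)
    (α' := ρ.pattern :: α)
    (by simp [Tree.rename, Tree.ids]) hdis (by simp [RawGraph.rename, hL]) e₁ hxn hl e₂ hν hβn e₃
  refine ⟨_, _, ⟨ρ, hρ, f, q, ν, a, hq, hdef, rfl, ?_, hν, rfl⟩, h₃, ?_,
    C, s, q, f, rfl, rfl⟩
  · exact (h₂'.mem_L ν).2 ⟨a, hν ▸ h₂'.mem_items_label hνi⟩
  · rw [← h₃.labels_front, Tree.front, e₃, List.map_append, List.map_cons, List.map_append,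
      interpolate_label_right (h₂'.mem_nodes.2 hνi), hν,
      List.map_congr_left fun n hn => interpolate_label_left hdis (h.mem_nodes.2 ?_), hxn,
      List.map_congr_left (l := βn) fun n hn => interpolate_label_right (h₂'.mem_nodes.2 ?_),
      hβn, List.map_congr_left fun n hn => interpolate_label_left hdis (h.mem_nodes.2 ?_), hαn]
    · simp
    · exact Tree.front_subset (by rw [hxl]; exact List.mem_append_right _ (.tail _ hn))
    · exact Tree.front_subset (e₂ ▸ .tail _ hn)
    · exact Tree.front_subset (by rw [hxl]; exact List.mem_append_left _ hn)

end Moves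

/-! ### Context-free languages are GILs -/

section ContextFree

variable {T : Type u}

/-- A chain of siblings without children, with consecutive nodes from `k` on. -/
def siblings {V : Type v} (k : ℕ) : List V → Tree V T
  | [] => .nil
  | A :: As => .node k (.inl A) .nil (siblings (k + 1) As)

section siblings

variable {V : Type v} (k : ℕ) (As : List V)

theorem ids_siblings : (siblings k As : Tree V T).ids = List.range' k As.length := by
  induction As generalizing k with
  | nil => rfl
  | cons A As ih => simp [siblings, Tree.ids, ih, List.range'_succ]

theorem wf_siblings : (siblings k As : Tree V T).WF ∧ (siblings k As : Tree V T).TopNonlex := by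
  induction As generalizing k with
  | nil => exact ⟨trivial, trivial⟩
  | cons A As ih => exact ⟨⟨trivial, (ih _).1, (ih _).2, by simp⟩, A, rfl⟩

theorem frontLabels_siblings : (siblings k As : Tree V T).frontLabels = As.map .inl := by
  induction As generalizing k with
  | nil => rfl
  | cons A As ih =>
    rw [siblings, Tree.frontLabels, Tree.walk_leaf]
    exact congrArg (.inl A :: ·) (ih _)

theorem inr_notMem_siblings (n : ℕ) (a : T) : (n, .inr a) ∉ (siblings k As : Tree V T).items := by
  induction As generalizing k with
  | nil => simp [siblings, Tree.items]
  | cons A As ih => simp [siblings, Tree.items, ih]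

end siblings

/-- The children of the root of the addendum for `A → a As`: a preterminal node above the lexeme
`a`, followed by the nodes `As`. -/
def productionTree {V : Type v} (A : V) (a : T) (As : List V) : Tree V T :=
  .node 1 (.inl A) (.node 2 (.inr a) .nil .nil) (siblings 3 As)

theorem nodup_productionTree {V : Type v} (A : V) (a : T) (As : List V) :
    (0 :: (productionTree A a As).ids).Nodup := by
  simp only [productionTree, Tree.ids, ids_siblings, List.nodup_cons, List.mem_cons,
    List.mem_append, List.mem_range'_1, List.nodup_append]
  simp [List.nodup_range']
  rintro b hb - rfl
  omega

theorem wf_productionTree {V : Type v} (A : V) (a : T) (As : List V) :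
    (productionTree A a As).WF :=
  ⟨⟨trivial, trivial, trivial, by simp⟩, (wf_siblings _ _).1, (wf_siblings _ _).2, by simp⟩

/-- The `ε`-shift rule for the production `A → a As`. -/
def productionRule {V : Type v} (A : V) (a : T) (As : List V) : Rule V T :=
  treeRule A A (productionTree A a As) 0 (nodup_productionTree A a As) (wf_productionTree A a As)
    (.head _)

theorem rep_productionRule {V : Type v} (A : V) (a : T) (As : List V) :
    Rep (productionRule A a As).addendum (.node 0 (.inl A) (productionTree A a As) .nil) :=
  rep_toGraph_node A (nodup_productionTree A a As) (wf_productionTree A a As)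

theorem frontLabels_productionTree {V : Type v} (A : V) (a : T) (As : List V) :
    (productionTree A a As).frontLabels = .inr a :: As.map .inl := by
  rw [productionTree, Tree.frontLabels, Tree.walk_node _ _ _ _ _ (by simp)]
  exact congrArg (.inr a :: ·) (frontLabels_siblings 3 As)

theorem L_productionRule {V : Type v} (A : V) (a : T) (As : List V) :
    (productionRule A a As).addendum.L = {2} := by
  ext n
  rw [(rep_productionRule A a As).mem_L]
  simp [productionTree, Tree.items, inr_notMem_siblings]

/-- The language denoted by a label in a sentential form over a Greibach system. -/
def labelLang (S : GreibachSystem T) : Fin S.n ⊕ T → Language T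
  | .inl i => S.lang i
  | .inr a => {[a]}

theorem mem_prod_labelLang_inr (S : GreibachSystem T) (w v : List T) :
    v ∈ ((w.map .inr).map (labelLang S)).prod ↔ v = w := by
  induction w generalizing v with
  | nil => simp [Language.mem_one]
  | cons a w ih =>
    simp only [List.map_cons, List.prod_cons, Language.mem_mul, ih]
    constructor
    · rintro ⟨x, hx, y, rfl, rfl⟩
      rw [show x = [a] from hx]
      rfl
    · rintro rfl
      exact ⟨[a], rfl, w, rfl, rfl⟩

/-- The grammar with a rule for every production `i → a is` that a Greibach system admits. -/
abbrev greibachGIG (S : GreibachSystem T) (s : Fin S.n) : GIG T where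
  V := Fin S.n
  rules := (fun p : Fin S.n × T × List (Fin S.n) => productionRule p.1 p.2.1 p.2.2) ''
    {p | p.2.1 ∈ S.letters ∧ p.2.2.length ≤ 3 ∧
      ∀ v ∈ (p.2.2.map S.lang).prod, p.2.1 :: v ∈ S.lang p.1}
  finite_rules := by
    refine Set.Finite.image _ (Set.Finite.subset
      (Set.finite_univ.prod (S.finite_letters.prod (List.finite_length_le (Fin S.n) 3))) ?_)
    rintro ⟨i, a, is⟩ ⟨h₁, h₂, -⟩
    exact ⟨trivial, h₁, h₂⟩
  start := s

theorem greibachGIG_sound (S : GreibachSystem T) (s : Fin S.n) {w : List T}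
    (hw : w ∈ (greibachGIG S s).language) : w ∈ S.lang s := by
  obtain ⟨Γ, l, hsteps, hl, hlw⟩ := hw
  -- every string denoted by the labels of the frontier belongs to the language
  have inv : ∀ J : RawGraph (Fin S.n) T × List T,
      Relation.ReflTransGen (greibachGIG S s).Step (RawGraph.single s, w) J →
      ∃ b, Rep J.1 b ∧ ∀ v ∈ (b.frontLabels.map (labelLang S)).prod, v ∈ S.lang s := by
    intro J hJ
    induction hJ with
    | refl => exact ⟨_, rep_single s, by simp [labelLang]⟩
    | @tail I J _ hstep ih =>
      obtain ⟨b, hb, hinv⟩ := ih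
      obtain ⟨ρ, ⟨⟨i, a, is⟩, ⟨-, -, hp⟩, rfl⟩, f, q, ν, a', hq, hdef, hJ, -⟩ := hstep
      obtain ⟨b', hb', u, v, e₁, e₂⟩ :=
        exists_rep_of_interpolationDefined_root hb (rep_productionRule i a is)
          (by simp [productionTree]) rfl hq hdef        (fun l => [l]) (fun _ => []) (fun _ => [])
      refine ⟨b', hJ ▸ hb', fun x hx => hinv x ?_⟩
      have hc : (productionTree i a is).walk (fun _ l => [l]) (fun _ => []) (fun _ => []) = _ :=
        frontLabels_productionTree i a is
      rw [Tree.frontLabels] at hx ⊢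
      rw [e₂, hc] at hx
      rw [e₁]
      simp only [List.map_append, List.prod_append, Language.mem_mul, List.nil_append,
        List.append_nil, List.map_cons, List.prod_cons, List.map_map] at hx ⊢
      obtain ⟨x₁, ⟨y, hy, z, ⟨a'', ha, z', hz, rfl⟩, rfl⟩, x₂, hx₂, rfl⟩ := hx
      refine ⟨_, ⟨y, hy, a'' ++ z', ?_, rfl⟩, x₂, hx₂, rfl⟩
      rw [show a'' = [a] from ha]
      exact ⟨a :: z', hp z' hz, [], rfl, List.append_nil _⟩
  obtain ⟨b, hb, hinv⟩ := inv _ hsteps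
  obtain rfl := hb.isFrontier_iff.1 hl
  refine hinv w ?_
  rw [← hb.labels_front, hlw, mem_prod_labelLang_inr]

/-- The remaining input can be scanned if it belongs to the product of the languages of the
nonlexical terminal nodes. -/
theorem greibachGIG_complete (S : GreibachSystem T) (s : Fin S.n) {w x : List T}
    {is : List (Fin S.n)} {Γ : RawGraph (Fin S.n) T} {b : Tree (Fin S.n) T} (hb : Rep Γ b)
    (hfl : b.frontLabels = x.map .inr ++ is.map .inl) (hw : w ∈ (is.map S.lang).prod) :
    ∃ Γ' b', Relation.ReflTransGen (greibachGIG S s).Step (Γ, w) (Γ', []) ∧ Rep Γ' b' ∧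
      b'.frontLabels = (x ++ w).map .inr := by
  induction w generalizing x is Γ b with
  | nil =>
    cases is with
    | nil => exact ⟨Γ, b, .refl, hb, by simpa using hfl⟩
    | cons i is =>
      rw [List.map_cons, List.prod_cons, Language.mem_mul] at hw
      obtain ⟨v, hv, y, -, h⟩ := hw
      rw [(List.append_eq_nil_iff.1 h).1] at hv
      exact absurd hv (S.nil_notMem i)
  | cons a w ih =>
    cases is with
    | nil => simp [Language.mem_one] at hw
    | cons i is =>
      rw [List.map_cons, List.prod_cons, Language.mem_mul] at hw
      obtain ⟨v, hv, y, hy, h⟩ := hw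
      obtain ⟨c, v, rfl⟩ : ∃ c v', v = c :: v' :=
        List.exists_cons_of_ne_nil (by rintro rfl; exact S.nil_notMem i hv)
      obtain ⟨rfl, rfl⟩ := List.cons.inj h
      obtain ⟨js, hjs, hvj, hc⟩ := S.factor i c v hv
      obtain ⟨Γ', b', hstep, hb', hfl', -⟩ := exists_step_root (G := greibachGIG S s) hb
        (ρ := productionRule i c js)
        ⟨(i, c, js), ⟨S.mem_letters i c v hv, hjs, hc⟩, rfl⟩ (rep_productionRule i c js) rfl
        (L_productionRule i c js) (frontLabels_productionTree i c js) hfl (v ++ y)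
      obtain ⟨Γ'', b'', hsteps, hb'', hfl''⟩ := ih hb' hfl' (by
        rw [List.map_append, List.prod_append, Language.mem_mul]
        exact ⟨v, hvj, y, hy, rfl⟩)
      exact ⟨Γ'', b'', .head hstep hsteps, hb'', by simpa using hfl''⟩

theorem isGIL_of_isContextFree {L : Language T} (hL : L.IsContextFree) :
    IsGIL ({w | w ∈ L ∧ w ≠ []} : Language T) := by
  obtain ⟨S, s, hS⟩ := exists_greibachSystem hL
  refine ⟨greibachGIG S s, Set.ext fun w => ?_⟩
  refine Iff.trans ⟨greibachGIG_sound S s, fun hw => ?_⟩ (hS w)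
  obtain ⟨Γ, b, hsteps, hb, hfl⟩ := greibachGIG_complete S s (w := w) (x := []) (is := [s])
    (rep_single s) rfl (by simpa using hw)
  exact ⟨Γ, b.front, hsteps, hb.isFrontier_iff.2 rfl, by rw [hb.labels_front, hfl]; rfl⟩

end ContextFree

/-! ### A grammar for the strings `aⁿbⁿcⁿdⁿ` -/

section FourCounts

variable {T : Type u}

/-- The terminal nodes with their labels, from left to right. -/
abbrev Tree.pairs {V : Type v} (b : Tree V T) : List (ℕ × (V ⊕ T)) :=
  b.walk (fun n l => [(n, l)]) (fun _ => []) (fun _ => [])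

theorem Tree.pairs_map_fst {V : Type v} (b : Tree V T) : b.pairs.map Prod.fst = b.front := by
  simpa [List.map_eq_flatMap] using
    b.walk_flatMap (fun n l => [(n, l)]) (fun _ => []) (fun _ => []) (fun p => [p.1])

theorem Tree.pairs_map_snd {V : Type v} (b : Tree V T) :
    b.pairs.map Prod.snd = b.frontLabels := by
  simpa [List.map_eq_flatMap] using
    b.walk_flatMap (fun n l => [(n, l)]) (fun _ => []) (fun _ => []) (fun p => [p.2])

theorem Rep.map_label_of_pairs {V : Type v} {Γ : RawGraph V T} {b : Tree V T} (h : Rep Γ b)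
    {l : List (ℕ × (V ⊕ T))} (hl : l ⊆ b.pairs) : (l.map Prod.fst).map Γ.label = l.map Prod.snd := by
  have := h.labels_front
  rw [← Tree.pairs_map_fst, ← Tree.pairs_map_snd, List.map_map, List.map_inj_left] at this
  rw [List.map_map, List.map_inj_left]
  exact fun p hp => this p (hl hp)

/-- Composition of contexts. -/
def Ctx.comp {V : Type v} : Ctx V T → Ctx V T → Ctx V T
  | hole, D => D
  | child n l C s, D => child n l (C.comp D) s
  | sib n l c C, D => sib n l c (C.comp D)

theorem Ctx.fill_comp {V : Type v} (C D : Ctx V T) (b : Tree V T) :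
    (C.comp D).fill b = C.fill (D.fill b) := by
  induction C <;> simp_all [Ctx.comp, Ctx.fill]

/-- The variables of the grammar.  A node labelled `mid` has the `b`s and `c`s as its descendants;
`B`, `C` and `D` stand for single letters that are still to be scanned. -/
inductive CountVar
  | start | mid | B | C | D | aux

open CountVar

/-- The children of the root of the initial addendum. -/
def initTree (a : T) : Tree CountVar T :=
  .node 1 (.inl aux) (.node 2 (.inr a) .nil .nil)
    (.node 3 (.inl mid) (.node 4 (.inl B) .nil (.node 5 (.inl C) .nil .nil))
      (.node 6 (.inl D) .nil .nil))

/-- The part of the recursive addendum around its target `f 5` and the right sibling of that, with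
the nodes renamed by `f`. -/
def adjoinCtx (a : T) (f : ℕ → ℕ) : Ctx CountVar T :=
  .sib (f 1) (.inl aux) (.node (f 2) (.inr a) .nil .nil)
    (.child (f 3) (.inl mid) (.sib (f 4) (.inl B) .nil .hole) (.node (f 7) (.inl D) .nil .nil))

/-- The children of the root of the recursive addendum. -/
def adjoinTree (a : T) : Tree CountVar T :=
  (adjoinCtx a id).fill (.node 5 (.inl aux) .nil (.node 6 (.inl C) .nil .nil))

theorem nodup_initTree (a : T) : (0 :: (initTree a).ids).Nodup := by
  simp [initTree, Tree.ids]

theorem wf_initTree (a : T) : (initTree a).WF := by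
  simp [initTree, Tree.WF, Tree.TopNonlex]

theorem nodup_adjoinTree (a : T) : (0 :: (adjoinTree a).ids).Nodup := by
  simp [adjoinTree, adjoinCtx, Ctx.fill, Tree.ids]

theorem wf_adjoinTree (a : T) : (adjoinTree a).WF := by
  simp [adjoinTree, adjoinCtx, Ctx.fill, Tree.WF, Tree.TopNonlex]

theorem five_mem_adjoinTree (a : T) : 5 ∈ (adjoinTree a).ids := by
  simp [adjoinTree, adjoinCtx, Ctx.fill, Tree.ids]

/-- The rule that creates one letter of each kind. -/
def initRule (a : T) : Rule CountVar T :=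
  treeRule start aux (initTree a) 0 (nodup_initTree a) (wf_initTree a) (.head _)

/-- The recursive rule, a down-shift: it moves the children of the anchor `mid` to the target, and
surrounds them with one more letter of each kind. -/
def adjoinRule (a : T) : Rule CountVar T :=
  treeRule mid aux (adjoinTree a) 5 (nodup_adjoinTree a) (wf_adjoinTree a)
    (.tail _ (five_mem_adjoinTree a))

theorem rep_initRule (a : T) :
    Rep (initRule a).addendum (.node 0 (.inl aux) (initTree a) .nil) :=
  rep_toGraph_node aux (nodup_initTree a) (wf_initTree a)

theorem rep_adjoinRule (a : T) :
    Rep (adjoinRule a).addendum (.node 0 (.inl aux) (adjoinTree a) .nil) :=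
  rep_toGraph_node aux (nodup_adjoinTree a) (wf_adjoinTree a)

theorem rep_rename_adjoinRule (a : T) (f : Equiv.Perm ℕ) :
    Rep ((adjoinRule a).addendum.rename f) (.node (f 0) (.inl aux) ((adjoinCtx a f).fill
      (.node (f 5) (.inl aux) .nil (.node (f 6) (.inl C) .nil .nil))) .nil) :=
  (rep_adjoinRule a).rename f

/-- The five rules. -/
def countRule (a b c d : T) : Fin 5 → Rule CountVar T
  | 0 => initRule a
  | 1 => adjoinRule a
  | 2 => productionRule B b []
  | 3 => productionRule C c []
  | 4 => productionRule D d []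

theorem countRule_injective (a b c d : T) : Function.Injective (countRule a b c d) := by
  intro i j h
  have := congrArg Rule.pattern h
  fin_cases i <;> fin_cases j <;> first | rfl |
    simp [countRule, initRule, adjoinRule, treeRule, productionRule] at this

/-- The grammar for the strings `aⁿbⁿcⁿdⁿ`. -/
abbrev countGIG (a b c d : T) : GIG T where
  V := CountVar
  rules := Set.range (countRule a b c d)
  finite_rules := Set.finite_range _
  start := start

theorem ncard_rules_countGIG (a b c d : T) : (countGIG a b c d).rules.ncard = 5 := by
  change (Set.range (countRule a b c d)).ncard = 5
  rw [← Set.image_univ, Set.ncard_image_of_injective _ (countRule_injective a b c d),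
    Set.ncard_univ, Nat.card_eq_fintype_card, Fintype.card_fin]

theorem shift_countRule (a b c d : T) (i : Fin 5) :
    (countRule a b c d i).addendum.IsDownShift (countRule a b c d i).target ∨
      (countRule a b c d i).addendum.IsEpsilonShift (countRule a b c d i).target := by
  fin_cases i
  · exact .inr rfl
  · exact .inl ((rep_adjoinRule a).isDownShift (five_mem_adjoinTree a))
  · exact .inr rfl
  · exact .inr rfl
  · exact .inr rfl

/-! ### Soundness of the grammar -/

section Sound

variable (b c d : T)

/-- The letter that a terminal node contributes to the final string. -/
def letterOf : CountVar ⊕ T → CountVar ⊕ T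
  | .inl B => .inr b
  | .inl C => .inr c
  | .inl D => .inr d
  | l => l

/-- A bracket for the boundary of the children of a node labelled `mid`. -/
def midBracket (i : Bool) : CountVar ⊕ T → List (Bool ⊕ (CountVar ⊕ T))
  | .inl mid => [.inl i]
  | _ => []

/-- The frontier, with every label replaced by the letter to which it will give rise, and with
brackets that enclose the frontier below a node labelled `mid`. -/
abbrev bracketed (t : Tree CountVar T) : List (Bool ⊕ (CountVar ⊕ T)) :=
  t.walk (fun _ l => [.inr (letterOf b c d l)]) (midBracket true) (midBracket false)

/-- The bracketed frontier of the graphs obtained by `n` uses of the first two rules. -/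
def bracketedCounts (a : T) (n : ℕ) : List (Bool ⊕ (CountVar ⊕ T)) :=
  List.replicate n (.inr (.inr a)) ++ .inl true ::
    (List.replicate n (.inr (.inr b)) ++ List.replicate n (.inr (.inr c)) ++ .inl false ::
      List.replicate n (.inr (.inr d)))

variable {b c d}

theorem inr_inl_notMem_bracketedCounts {a : T} {n : ℕ} {A : CountVar} :
    .inr (.inl A) ∉ bracketedCounts b c d a n := by
  simp [bracketedCounts, List.mem_replicate]

theorem flatMap_bracketed (t : Tree CountVar T) :
    (bracketed b c d t).flatMap (Sum.elim (fun _ => []) fun l => [l]) =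
      t.frontLabels.map (letterOf b c d) := by
  rw [Tree.walk_flatMap, List.map_eq_flatMap, Tree.walk_flatMap]
  congr 1
  all_goals
    funext l
    rcases l with (_ | _ | _ | _ | _ | _) | _ <;> rfl

/-- An adjunction at the node labelled `mid` adds one letter of each kind. -/
theorem bracketed_adjoin {a : T} {n : ℕ} {u v x : List (Bool ⊕ (CountVar ⊕ T))}
    (h : bracketedCounts b c d a n = u ++ .inl true :: (x ++ .inl false :: v)) :
    bracketedCounts b c d a (n + 1) = u ++ .inr (.inr a) :: .inl true :: (.inr (.inr b) ::
      (x ++ .inr (.inr c) :: .inl false :: .inr (.inr d) :: v)) := by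
  rw [bracketedCounts, List.append_cons_inj_of_notMem (by simp [List.mem_replicate])
    (by simp [List.mem_replicate])] at h
  obtain ⟨rfl, -, h⟩ := h
  rw [List.append_cons_inj_of_notMem (by simp [List.mem_replicate])
    (by simp [List.mem_replicate])] at h
  obtain ⟨rfl, -, rfl⟩ := h
  rw [bracketedCounts, List.replicate_succ' (a := Sum.inr (Sum.inr a)),
    List.replicate_succ (a := Sum.inr (Sum.inr b)), List.replicate_succ' (a := Sum.inr (Sum.inr c)),
    List.replicate_succ (a := Sum.inr (Sum.inr d))]
  simp

/-- Every reachable graph has the right bracketed frontier. -/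
theorem bracketed_of_reachable {a : T} {w : List T} {J : RawGraph CountVar T × List T}
    (hJ : Relation.ReflTransGen (countGIG a b c d).Step (RawGraph.single start, w) J) :
    ∃ t, Rep J.1 t ∧ (bracketed b c d t = [.inr (.inl start)] ∨
      ∃ n, 1 ≤ n ∧ bracketed b c d t = bracketedCounts b c d a n) := by
  induction hJ with
  | refl => exact ⟨_, rep_single start, .inl (by simp [letterOf])⟩
  | @tail I J _ hstep ih =>
    obtain ⟨t, ht, hinv⟩ := ih
    obtain ⟨ρ, ⟨i, rfl⟩, f, q, ν, a', hq, hdef, hJ, -⟩ := hstep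
    rw [hJ]
    -- a rule that turns a terminal node into the letter for which it stands
    have hprod : ∀ A x, countRule a b c d i = productionRule A x [] →
        letterOf b c d (.inl A) = .inr x → midBracket (T := T) true (.inl A) = [] →
        midBracket (T := T) false (.inl A) = [] →
        ∃ t', Rep (I.1.interpolate ((countRule a b c d i).addendum.rename f) q
          (f (countRule a b c d i).target)) t' ∧ bracketed b c d t' = bracketed b c d t := by
      intro A x hr hA h₁ h₂
      rw [hr] at hq hdef ⊢
      obtain ⟨t', ht', u, v, e₁, e₂⟩ := exists_rep_of_interpolationDefined_root ht
        (rep_productionRule A x []) (by simp [productionTree]) rfl hq hdef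
        (fun l => [.inr (letterOf b c d l)]) (midBracket true) (midBracket false)
      refine ⟨t', ht', e₂.trans (Eq.trans ?_ e₁.symm)⟩
      have hpat : (productionRule A x []).pattern = A := rfl
      rw [hpat, hA, h₁, h₂, productionTree, Tree.walk_node _ _ _ _ _ (by simp), h₁, h₂, siblings]
      simp [letterOf]
    have hkeep : (∃ t', Rep (I.1.interpolate ((countRule a b c d i).addendum.rename f) q
          (f (countRule a b c d i).target)) t' ∧ bracketed b c d t' = bracketed b c d t) →
        ∃ t', Rep (I.1.interpolate ((countRule a b c d i).addendum.rename f) q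
          (f (countRule a b c d i).target)) t' ∧
          (bracketed b c d t' = [.inr (.inl start)] ∨
            ∃ n, 1 ≤ n ∧ bracketed b c d t' = bracketedCounts b c d a n) := by
      rintro ⟨t', ht', he⟩
      exact ⟨t', ht', by rwa [he]⟩
    fin_cases i
    · obtain ⟨t', ht', u, v, e₁, e₂⟩ := exists_rep_of_interpolationDefined_root ht
        (rep_initRule a) (by simp [initTree]) rfl hq hdef
        (fun l => [.inr (letterOf b c d l)]) (midBracket true) (midBracket false)
      refine ⟨t', ht', .inr ⟨1, le_rfl, ?_⟩⟩
      have hpat : letterOf b c d (.inl (initRule a).pattern) = .inl start := rfl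
      rw [hpat] at e₁
      rcases hinv with h | ⟨n, -, h⟩
      · rw [bracketed, e₁, List.append_assoc, List.append_eq_singleton_iff] at h
        simp at h
        obtain ⟨rfl, rfl⟩ := h
        rw [bracketed, e₂]
        simp [initTree, Tree.walk, midBracket, letterOf, bracketedCounts]
      · refine absurd ?_ (inr_inl_notMem_bracketedCounts (b := b) (c := c) (d := d) (a := a)
          (n := n) (A := start))
        rw [← h, bracketed, e₁]
        simp
    · obtain ⟨C', ch, s, rfl⟩ :=
        ht.exists_anchor hdef.anchor_mem (show I.1.label q = .inl mid from hq)
      obtain ⟨u, v, huv⟩ := C'.exists_walk_fill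
        (fun _ l => [.inr (letterOf b c d l)]) (midBracket true) (midBracket false)
      have e₁ := huv (.node q (.inl mid) ch s) (by simp)
      by_cases hch : ch = .nil
      · -- a terminal node labelled `mid` cannot occur
        subst hch
        have hmem : .inr (.inl mid) ∈ bracketed b c d (C'.fill (.node q (.inl mid) .nil s)) := by
          rw [bracketed, e₁, Tree.walk_leaf]
          simp [letterOf]
        rcases hinv with h | ⟨n, -, h⟩
        · rw [h] at hmem
          simp at hmem
        · exact absurd (h ▸ hmem) inr_inl_notMem_bracketedCounts
      · have h₃ := ht.interpolate_down (rep_rename_adjoinRule a f) hdef.disjunction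
        have e₃ := huv (.node (f 0) (.inl aux) ((adjoinCtx a f).fill
          (.node (f 5) (.inl aux) ch (.node (f 6) (.inl C) .nil .nil))) s) (by simp)
        refine ⟨_, h₃, .inr ?_⟩
        rw [Tree.walk_node _ _ _ _ _ hch] at e₁
        rcases hinv with h | ⟨n, hn, h⟩
        · have hmem : .inl true ∈ bracketed b c d (C'.fill (.node q (.inl mid) ch s)) := by
            rw [bracketed, e₁]
            simp [midBracket]
          rw [h] at hmem
          simp at hmem
        · refine ⟨n + 1, by omega, ?_⟩
          rw [bracketed_adjoin (u := u) (x := bracketed b c d ch)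
            (v := bracketed b c d s ++ v), bracketed]
          · refine e₃.trans ?_
            have lB : letterOf b c d (.inl B) = .inr b := rfl
            have lC : letterOf b c d (.inl C) = .inr c := rfl
            have lD : letterOf b c d (.inl D) = .inr d := rfl
            have la : letterOf b c d (.inr a) = .inr a := rfl
            simp [adjoinCtx, Ctx.fill, Tree.walk, Tree.walk_node _ _ _ _ _ hch, midBracket, lB, lC,
              lD, la]
          · rw [← h, bracketed, e₁]
            simp [midBracket]
    · exact hkeep (hprod B b rfl rfl rfl rfl)
    · exact hkeep (hprod C c rfl rfl rfl rfl)
    · exact hkeep (hprod D d rfl rfl rfl rfl)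

theorem countGIG_sound {a : T} {w : List T} (hw : w ∈ (countGIG a b c d).language) :
    w ∈ fourCounts a b c d := by
  obtain ⟨Γ, l, hsteps, hl, hlw⟩ := hw
  obtain ⟨t, ht, hinv⟩ := bracketed_of_reachable hsteps
  obtain rfl := ht.isFrontier_iff.1 hl
  have hfl : t.frontLabels = w.map .inr := ht.labels_front.symm.trans hlw
  have he := flatMap_bracketed (b := b) (c := c) (d := d) t
  rw [hfl, List.map_map, show letterOf b c d ∘ .inr = .inr from rfl] at he
  rcases hinv with h | ⟨n, hn, h⟩
  · rw [h] at he
    have hmem : .inl start ∈ w.map (Sum.inr : T → CountVar ⊕ T) := he ▸ by simp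
    simp at hmem
  · refine ⟨n, hn, List.map_injective_iff.2 (Sum.inr_injective (α := CountVar)) ?_⟩
    rw [← he, h]
    simp [bracketedCounts, List.flatMap_replicate]

end Sound

/-! ### Completeness of the grammar -/

section Complete

variable {a b c d : T}

/-- Scanning the letters for which the terminal nodes stand, from left to right. -/
theorem exists_steps_of_letters {G : GIG T} {zs : List (G.V × T)}
    (hz : ∀ z ∈ zs, productionRule z.1 z.2 [] ∈ G.rules) {x : List T} {Γ : RawGraph G.V T}
    {t : Tree G.V T} (ht : Rep Γ t)
    (hfl : t.frontLabels = x.map .inr ++ (zs.map Prod.fst).map .inl) :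
    ∃ Γ' t', Relation.ReflTransGen G.Step (Γ, zs.map Prod.snd) (Γ', []) ∧ Rep Γ' t' ∧
      t'.frontLabels = (x ++ zs.map Prod.snd).map .inr := by
  induction zs generalizing x Γ t with
  | nil => exact ⟨Γ, t, .refl, ht, by simpa using hfl⟩
  | cons z zs ih =>
    obtain ⟨Γ', t', hstep, ht', hfl', -⟩ := exists_step_root ht (hz z (.head _))
      (rep_productionRule z.1 z.2 []) rfl (L_productionRule z.1 z.2 [])
      (frontLabels_productionTree z.1 z.2 []) hfl (zs.map Prod.snd)
    obtain ⟨Γ'', t'', hsteps, ht'', hfl''⟩ := ih (fun z h => hz z (.tail _ h)) ht' hfl'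
    exact ⟨Γ'', t'', .head hstep hsteps, ht'', by simpa using hfl''⟩

/-- A move by the recursive rule is possible when no `b` has been scanned. -/
theorem exists_step_adjoin {Γ : RawGraph CountVar T} {K : Ctx CountVar T} {q : ℕ}
    {ch s : Tree CountVar T} {P Q : List (ℕ × (CountVar ⊕ T))} {x : List T} {α : List CountVar}
    (h : Rep Γ (K.fill (.node q (.inl mid) ch s))) (hch : ch ≠ .nil)
    (hK : ∀ t : Tree CountVar T, t ≠ .nil → (K.fill t).pairs = P ++ t.pairs ++ Q)
    (hP : P.map Prod.snd = x.map .inr)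
    (hα : (ch.pairs ++ s.pairs ++ Q).map Prod.snd = α.map .inl) (w : List T) :
    ∃ (Γ' : RawGraph CountVar T) (f : Equiv.Perm ℕ),
      (countGIG a b c d).Step (Γ, a :: w) (Γ', w) ∧
      Rep Γ' (K.fill (.node (f 0) (.inl aux) ((adjoinCtx a f).fill
        (.node (f 5) (.inl aux) ch (.node (f 6) (.inl C) .nil .nil))) s)) := by
  obtain ⟨f, hdis⟩ := exists_disjoint_rename h (rep_adjoinRule a)
  have h₂ := rep_rename_adjoinRule a f
  have h₃ := h.interpolate_down h₂ hdis
  have e₁ : (K.fill (.node q (.inl mid) ch s)).pairs = P ++ (ch.pairs ++ s.pairs ++ Q) := by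
    rw [hK _ (by simp), Tree.pairs, Tree.walk_node _ _ _ _ _ hch]
    simp
  have hq : Γ.label q = .inl mid :=
    h.label _ _ ((K.items_fill _).mem_iff.2 (List.mem_append_right _ (.head _)))
  have hν : ((adjoinRule a).addendum.rename f).label (f 2) = .inr a :=
    h₂.label _ _ (by simp [adjoinCtx, Ctx.fill, Tree.items])
  have hL : ((adjoinRule a).addendum.rename f).L = {f 2} := by
    ext n
    rw [h₂.mem_L]
    simp [adjoinCtx, Ctx.fill, Tree.items]
  refine ⟨_, f, ⟨adjoinRule a, ⟨1, rfl⟩, f, q, f 2, a, hq, ?_, rfl, by rw [hL]; simp, hν, rfl⟩, h₃⟩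
  refine interpolationDefined_of_rep (x := P.map Prod.fst)
    (α := (ch.pairs ++ s.pairs ++ Q).map Prod.fst) (β := [f 4, f 5, f 6, f 7])
    (ζ := f 4 :: ch.front ++ f 6 :: f 7 :: (s.front ++ Q.map Prod.fst))
    (x' := x) (α' := α) (β' := [B, aux, C, D]) h h₂ h₃
    (Ctx.mem_ids_fill.2 (.inr (.head _))) hq ?_ hdis (by rw [hL]; simp) ?_ ?_ ?_ ?_ hν ?_ ?_
  · simp only [Tree.ids, List.mem_cons, List.mem_append]
    exact .inr (.inl (Ctx.mem_ids_fill.2 (.inr (.head _))))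
  · rw [← Tree.pairs_map_fst, e₁, List.map_append]
  · rw [h.map_label_of_pairs (e₁ ▸ List.subset_append_left _ _), hP]
  · rw [h.map_label_of_pairs (e₁ ▸ List.subset_append_right _ _), hα]
  · simp [adjoinCtx, Ctx.fill, Tree.walk]
  · have := h₂.labels_front
    simp only [adjoinCtx, Ctx.fill, Tree.front, Tree.frontLabels, Tree.walk] at this
    simpa [hν] using this
  · rw [← Tree.pairs_map_fst, hK _ (by simp)]
    simp [← Tree.pairs_map_fst, adjoinCtx, Ctx.fill, Tree.walk, Tree.walk_node _ _ _ _ _ hch]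

/-- The graphs with `n + 1` letters of each kind, of which the `a`s have been scanned. -/
theorem exists_steps_adjoin (a b c d : T) (n : ℕ) (w : List T) :
    ∃ (Γ : RawGraph CountVar T) (K : Ctx CountVar T) (q : ℕ) (ch s : Tree CountVar T)
      (P Q : List (ℕ × (CountVar ⊕ T))),
      Relation.ReflTransGen (countGIG a b c d).Step
        (RawGraph.single start, List.replicate (n + 1) a ++ w) (Γ, w) ∧
      Rep Γ (K.fill (.node q (.inl mid) ch s)) ∧ ch ≠ .nil ∧
      (∀ t : Tree CountVar T, t ≠ .nil → (K.fill t).pairs = P ++ t.pairs ++ Q) ∧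
      P.map Prod.snd = (List.replicate (n + 1) a).map .inr ∧
      ch.frontLabels = (List.replicate (n + 1) B ++ List.replicate (n + 1) C).map .inl ∧
      (s.pairs ++ Q).map Prod.snd = (List.replicate (n + 1) D).map .inl := by
  induction n generalizing w with
  | zero =>
    obtain ⟨Γ, t, hstep, ht, -, K, s, q, f, hK, rfl⟩ := exists_step_root
      (G := countGIG a b c d) (rep_single start) (ρ := initRule a) ⟨0, rfl⟩ (x := []) (α := [])
      (ν₀ := 2) (a := a) (β := [B, C, D]) (rep_initRule a) rfl
      (by ext n; rw [(rep_initRule a).mem_L]; simp [initTree, Tree.items])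
      (by simp [initTree, Tree.walk]) (by simp [initRule, treeRule]) w
    -- the context of the only node of the initial graph is trivial
    obtain ⟨rfl, rfl⟩ : K = .hole ∧ s = .nil := by
      cases K with
      | hole => simp_all [Ctx.fill]
      | child n l K s =>
        simp only [Ctx.fill, Tree.node.injEq] at hK
        exact absurd hK.2.2.1.symm (Ctx.fill_ne_nil (by simp))
      | sib n l t K =>
        simp only [Ctx.fill, Tree.node.injEq] at hK
        exact absurd hK.2.2.2.symm (Ctx.fill_ne_nil (by simp))
    refine ⟨Γ, .child (f 0) (.inl aux) (.sib (f 1) (.inl aux) (.node (f 2) (.inr a) .nil .nil) .hole)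
      .nil, f 3, .node (f 4) (.inl B) .nil (.node (f 5) (.inl C) .nil .nil),
      .node (f 6) (.inl D) .nil .nil, [(f 2, .inr a)], [], .single hstep, ht, by simp, ?_, by simp,
      by simp, by simp⟩
    intro t ht
    simp [Ctx.fill, Tree.walk, Tree.walk_node]
  | succ n ih =>
    obtain ⟨Γ, K, q, ch, s, P, Q, hsteps, h, hch, hK, hP, hfl, hQ⟩ := ih (a :: w)
    obtain ⟨Γ', f, hstep, h'⟩ := exists_step_adjoin (a := a) (b := b) (c := c) (d := d)
      (α := List.replicate (n + 1) B ++ List.replicate (n + 1) C ++ List.replicate (n + 1) D)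
      h hch hK hP (by
        rw [List.append_assoc, List.map_append, hQ, Tree.pairs_map_snd, hfl, ← List.map_append]) w
    refine ⟨Γ', K.comp (.child (f 0) (.inl aux)
      (.sib (f 1) (.inl aux) (.node (f 2) (.inr a) .nil .nil) .hole) s), f 3,
      .node (f 4) (.inl B) .nil (.node (f 5) (.inl aux) ch (.node (f 6) (.inl C) .nil .nil)),
      .node (f 7) (.inl D) .nil .nil, P ++ [(f 2, .inr a)], s.pairs ++ Q, ?_, ?_, by simp, ?_, ?_,
      ?_, ?_⟩
    · rw [List.replicate_succ', List.append_assoc]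
      exact hsteps.tail hstep
    · rw [Ctx.fill_comp]
      exact h'
    · intro t ht
      rw [Ctx.fill_comp, hK _ (Ctx.fill_ne_nil ht)]
      simp [Ctx.fill, Tree.walk, Tree.walk_node]
    · rw [List.map_append, hP, List.replicate_succ' (n := n + 1), List.map_append]
      rfl
    · rw [Tree.frontLabels, Tree.walk_leaf, Tree.walk_node _ _ _ _ _ hch,
        show ch.walk _ _ _ = _ from hfl, List.replicate_succ (n := n + 1) (a := B),
        List.replicate_succ' (n := n + 1) (a := C)]
      simp
    · rw [List.map_append, hQ, List.replicate_succ (n := n + 1)]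
      simp

theorem countGIG_complete {w : List T} (hw : w ∈ fourCounts a b c d) :
    w ∈ (countGIG a b c d).language := by
  obtain ⟨n, hn, rfl⟩ := hw
  obtain ⟨n, rfl⟩ : ∃ m, n = m + 1 := ⟨n - 1, by omega⟩
  set zs : List (CountVar × T) := List.replicate (n + 1) (B, b) ++ List.replicate (n + 1) (C, c) ++
    List.replicate (n + 1) (D, d) with hzs
  have hsnd : zs.map Prod.snd = List.replicate (n + 1) b ++ List.replicate (n + 1) c ++
    List.replicate (n + 1) d := by simp [hzs]
  obtain ⟨Γ, K, q, ch, s, P, Q, hsteps, h, hch, hK, hP, hfl, hQ⟩ :=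
    exists_steps_adjoin a b c d n (zs.map Prod.snd)
  obtain ⟨Γ', t', hsteps', ht', hfl'⟩ := exists_steps_of_letters (G := countGIG a b c d) (zs := zs)
    (x := List.replicate (n + 1) a) (by
      intro z hz
      simp only [hzs, List.mem_append, List.mem_replicate] at hz
      rcases hz with (⟨-, rfl⟩ | ⟨-, rfl⟩) | ⟨-, rfl⟩
      · exact ⟨2, rfl⟩
      · exact ⟨3, rfl⟩
      · exact ⟨4, rfl⟩) h (by
      rw [← Tree.pairs_map_snd, hK _ (by simp), Tree.pairs, Tree.walk_node _ _ _ _ _ hch]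
      rw [List.map_append] at hQ
      simp only [List.map_append, List.append_assoc, hP, List.nil_append]
      rw [hQ, show ch.walk _ _ _ = ch.pairs from rfl, Tree.pairs_map_snd, hfl]
      simp [hzs])
  refine ⟨Γ', t'.front, ?_, ht'.isFrontier_iff.2 rfl, ?_⟩
  · rw [List.append_assoc, List.append_assoc, ← List.append_assoc (List.replicate (n + 1) b),
      ← hsnd]
    exact hsteps.trans hsteps'
  · rw [ht'.labels_front, hfl', hsnd]
    simp

theorem language_countGIG (a b c d : T) : (countGIG a b c d).language = fourCounts a b c d :=
  Set.ext fun _ => ⟨countGIG_sound, countGIG_complete⟩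

end Complete

end FourCounts

end GraphInterp

theorem theorem3 {T : Type*} :
    -- every context-free language is a GIL, up to the empty string
    (∀ L : Language T, L.IsContextFree → GraphInterp.IsGIL ({w | w ∈ L ∧ w ≠ []} : Language T)) ∧
    -- the witness, for any four distinct symbols
    (∀ a b c d : T, [a, b, c, d].Nodup →
      (∃ G : GraphInterp.GIG T, G.rules.ncard = 5 ∧
        (∀ ρ ∈ G.rules,
          ρ.addendum.IsDownShift ρ.target ∨ ρ.addendum.IsEpsilonShift ρ.target) ∧
        G.language = GraphInterp.fourCounts a b c d) ∧
      ¬ (GraphInterp.fourCounts a b c d).IsContextFree ∧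
      -- proper inclusion of the two classes of languages
      {L : Language T | L.IsContextFree ∧ [] ∉ L} ⊂ {L : Language T | GraphInterp.IsGIL L}) := by
  refine ⟨fun L hL => GraphInterp.isGIL_of_isContextFree hL, fun a b c d hnd => ?_⟩
  have hlang := GraphInterp.language_countGIG a b c d
  have hncf := GraphInterp.not_isContextFree_fourCounts hnd
  refine ⟨⟨_, GraphInterp.ncard_rules_countGIG a b c d, ?_, hlang⟩, hncf, ?_⟩
  · rintro _ ⟨i, rfl⟩
    exact GraphInterp.shift_countRule a b c d i
  · refine ⟨fun L hL => ?_, fun h => hncf (h ⟨_, hlang⟩).1⟩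
    have he : ({w | w ∈ L ∧ w ≠ []} : Language T) = L :=
      Set.ext fun w => ⟨And.left, fun hw => ⟨hw, fun h => hL.2 (h ▸ hw)⟩⟩
    exact he ▸ GraphInterp.isGIL_of_isContextFree hL.1
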